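/- Let $K$ be a field. A finite directed graph $E=(E^0,E^1,r,s)$ consists of finite sets $E^0$ (vertices) and $E^1$ (edges) and maps $r,s\colon E^1\to E^0$; a *source* of $E$ is a vertex $v$ with $r^{-1}(v)=\emptyset$. The Leavitt path algebra $L_K(E)$ is the $K$-algebra generated by pairwise orthogonal idempotents $v$ ($v\in E^0$) and elements $e,e^*$ ($e\in E^1$) subject to $s(e)e=e=e\,r(e)$, $r(e)e^*=e^*=e^*s(e)$, $e^*f=\delta_{e,f}\,r(e)$ for $e,f\in E^1$, and $v=\sum_{s(e)=v}ee^*$ for every vertex $v$ with $s^{-1}(v)\neq\emptyset$; since $E$ is finite it is unital with $1=\sum_{v\in E^0}v$. It is $\mathbb Z$-graded: $L_K(E)_n$ is the linear span of the elements $pq^*$, where $p,q$ are paths (vertices being the paths of length $0$) with the same range and $|p|-|q|=n$. For a $\mathbb Z$-graded algebra $A$, $K_0^{\mathrm{gr}}(A)$ is the Grothendieck group of the abelian monoid of graded isomorphism classes of finitely generated graded projective right $A$-modules, and a graded algebra isomorphism $\varphi\colon A\to B$ (one with $\varphi(A_n)=B_n$ for all $n$) induces $K_0^{\mathrm{gr}}(\varphi)\colon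 K_0^{\mathrm{gr}}(A)\to K_0^{\mathrm{gr}}(B)$, $[P]\mapsto[P\otimes_A B]$; equivalently, $P\otimes_A B$ is $P$ with the same grading and $B$ acting through $\varphi^{-1}$. For a finite graph $F$ and invertible elements $u,z$ of $L_K(F)_0$ such that $z(uvu^{-1})=(uvu^{-1})z$ for all $v\in F^0$, let $\theta_{u,z}$ be the $K$-algebra endomorphism of $L_K(F)$ determined by $$\theta_{u,z}(v)=uvu^{-1}\ (v\in F^0),\qquad \theta_{u,z}(e)=(ueu^{-1})z,\qquad \theta_{u,z}(e^*)=z^{-1}(ue^*u^{-1})\ (e\in F^1).$$ **Theorem.** Let $E$ and $F$ be finite graphs without sources, and let $\varphi,\psi\colon L_K(E)\to L_K(F)$ be graded $K$-algebra isomorphisms such that $K_0^{\mathrm{gr}}(\varphi)=K_0^{\mathrm{gr}}(\psi)$. Then there exist invertible elements $u,z$ of $L_K(F)_0$, with $z(uvu^{-1})=(uvu^{-1})z$ for all $v\in F^0$, such that $$\psi=\theta_{u,z}\circ\varphi .$$ -/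

import Mathlib

/-! ## Leavitt path algebras of finite graphs

A (directed) graph is a `Quiver V`: the set of vertices is `V`, the set of edges is
`Quiver.Total V`, and an edge `e` points from its source `e.left` to its range `e.right`. -/

/-- A graph has no sources: every vertex is the range of some edge. -/
def HasNoSources (V : Type*) [Quiver V] : Prop :=
  ∀ v : V, ∃ e : Quiver.Total V, e.right = v

/-- The free generators `v`, `e`, `e^*` of the Leavitt path algebra. -/
inductive LeavittGen (V : Type*) [Quiver V]
  | vertex (v : V) : LeavittGen V
  | edge (e : Quiver.Total V) : LeavittGen V
  | ghost (e : Quiver.Total V) : LeavittGen V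

open scoped Classical in
/-- A Leavitt family for the finite graph `V` in a unital algebra `A`: pairwise orthogonal
idempotents `v` with sum `1`, and elements `e`, `e^*`, satisfying the defining relations of the
Leavitt path algebra. (For a finite graph the algebra is unital with unit the sum of the vertices,
so it is the unital algebra presented by these relations.) -/
structure IsLeavittFamily (V : Type*) [Quiver V] [Fintype V] [Fintype (Quiver.Total V)]
    {A : Type*} [Ring A] (x : LeavittGen V → A) : Prop where
  vertex_mul_self : ∀ v, x (.vertex v) * x (.vertex v) = x (.vertex v)
  vertex_mul_vertex_of_ne : ∀ v w, v ≠ w → x (.vertex v) * x (.vertex w) = 0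
  sum_vertex : ∑ v, x (.vertex v) = 1
  source_mul_edge : ∀ e, x (.vertex e.left) * x (.edge e) = x (.edge e)
  edge_mul_range : ∀ e, x (.edge e) * x (.vertex e.right) = x (.edge e)
  range_mul_ghost : ∀ e, x (.vertex e.right) * x (.ghost e) = x (.ghost e)
  ghost_mul_source : ∀ e, x (.ghost e) * x (.vertex e.left) = x (.ghost e)
  ghost_mul_edge_self : ∀ e, x (.ghost e) * x (.edge e) = x (.vertex e.right)
  ghost_mul_edge_of_ne : ∀ e f, e ≠ f → x (.ghost e) * x (.edge f) = 0
  vertex_eq_sum : ∀ v, (∃ e : Quiver.Total V, e.left = v) →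
    x (.vertex v) = ∑ e : Quiver.Total V with e.left = v, x (.edge e) * x (.ghost e)

section Leavitt

variable (K : Type*) [Field K] (V : Type*) [Quiver V] [Fintype V] [Fintype (Quiver.Total V)]

open FreeAlgebra in
open scoped Classical in
/-- The defining relations of the Leavitt path algebra, on the free algebra. -/
inductive LeavittRel : FreeAlgebra K (LeavittGen V) → FreeAlgebra K (LeavittGen V) → Prop
  | vertex_mul_self (v : V) :
      LeavittRel (ι K (.vertex v) * ι K (.vertex v)) (ι K (.vertex v))
  | vertex_mul_vertex_of_ne (v w : V) (h : v ≠ w) :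
      LeavittRel (ι K (.vertex v) * ι K (.vertex w)) 0
  | sum_vertex : LeavittRel (∑ v : V, ι K (.vertex v)) 1
  | source_mul_edge (e : Quiver.Total V) :
      LeavittRel (ι K (.vertex e.left) * ι K (.edge e)) (ι K (.edge e))
  | edge_mul_range (e : Quiver.Total V) :
      LeavittRel (ι K (.edge e) * ι K (.vertex e.right)) (ι K (.edge e))
  | range_mul_ghost (e : Quiver.Total V) :
      LeavittRel (ι K (.vertex e.right) * ι K (.ghost e)) (ι K (.ghost e))
  | ghost_mul_source (e : Quiver.Total V) :
      LeavittRel (ι K (.ghost e) * ι K (.vertex e.left)) (ι K (.ghost e))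
  | ghost_mul_edge_self (e : Quiver.Total V) :
      LeavittRel (ι K (.ghost e) * ι K (.edge e)) (ι K (.vertex e.right))
  | ghost_mul_edge_of_ne (e f : Quiver.Total V) (h : e ≠ f) :
      LeavittRel (ι K (.ghost e) * ι K (.edge f)) 0
  | vertex_eq_sum (v : V) (h : ∃ e : Quiver.Total V, e.left = v) :
      LeavittRel (ι K (.vertex v))
        (∑ e : Quiver.Total V with e.left = v, ι K (.edge e) * ι K (.ghost e))

/-- The Leavitt path algebra `L_K(E)` of the finite graph `E = V`. -/
abbrev LeavittPathAlgebra := RingQuot (LeavittRel K V)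

namespace LeavittPathAlgebra

/-- The canonical generators of `L_K(E)`. -/
noncomputable def gen (g : LeavittGen V) : LeavittPathAlgebra K V :=
  RingQuot.mkAlgHom K (LeavittRel K V) (FreeAlgebra.ι K g)

/-- The vertex `v` as an element of `L_K(E)`. -/
noncomputable abbrev vertex (v : V) : LeavittPathAlgebra K V := gen K V (.vertex v)

/-- The edge `e` as an element of `L_K(E)`. -/
noncomputable abbrev edge (e : Quiver.Total V) : LeavittPathAlgebra K V := gen K V (.edge e)

/-- The ghost edge `e^*` as an element of `L_K(E)`. -/
noncomputable abbrev ghost (e : Quiver.Total V) : LeavittPathAlgebra K V := gen K V (.ghost e)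

theorem isLeavittFamily_gen : IsLeavittFamily V (gen K V) where
  vertex_mul_self v := by
    simpa [gen] using RingQuot.mkAlgHom_rel K (LeavittRel.vertex_mul_self (K := K) v)
  vertex_mul_vertex_of_ne v w h := by
    simpa [gen] using RingQuot.mkAlgHom_rel K (LeavittRel.vertex_mul_vertex_of_ne (K := K) v w h)
  sum_vertex := by
    simpa [gen] using RingQuot.mkAlgHom_rel K (LeavittRel.sum_vertex (K := K) (V := V))
  source_mul_edge e := by
    simpa [gen] using RingQuot.mkAlgHom_rel K (LeavittRel.source_mul_edge (K := K) e)
  edge_mul_range e := by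
    simpa [gen] using RingQuot.mkAlgHom_rel K (LeavittRel.edge_mul_range (K := K) e)
  range_mul_ghost e := by
    simpa [gen] using RingQuot.mkAlgHom_rel K (LeavittRel.range_mul_ghost (K := K) e)
  ghost_mul_source e := by
    simpa [gen] using RingQuot.mkAlgHom_rel K (LeavittRel.ghost_mul_source (K := K) e)
  ghost_mul_edge_self e := by
    simpa [gen] using RingQuot.mkAlgHom_rel K (LeavittRel.ghost_mul_edge_self (K := K) e)
  ghost_mul_edge_of_ne e f h := by
    simpa [gen] using RingQuot.mkAlgHom_rel K (LeavittRel.ghost_mul_edge_of_ne (K := K) e f h)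
  vertex_eq_sum v h := by
    simpa [gen] using RingQuot.mkAlgHom_rel K (LeavittRel.vertex_eq_sum (K := K) v h)

variable {K V}

/-- The algebra homomorphism out of `L_K(E)` determined by a Leavitt family. -/
noncomputable def lift {A : Type*} [Ring A] [Algebra K A] (x : LeavittGen V → A)
    (hx : IsLeavittFamily V x) : LeavittPathAlgebra K V →ₐ[K] A :=
  RingQuot.liftAlgHom K ⟨FreeAlgebra.lift K x, by
    intro a b h
    induction h with
    | vertex_mul_self v => simpa using hx.vertex_mul_self v
    | vertex_mul_vertex_of_ne v w h => simpa using hx.vertex_mul_vertex_of_ne v w h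
    | sum_vertex => simpa using hx.sum_vertex
    | source_mul_edge e => simpa using hx.source_mul_edge e
    | edge_mul_range e => simpa using hx.edge_mul_range e
    | range_mul_ghost e => simpa using hx.range_mul_ghost e
    | ghost_mul_source e => simpa using hx.ghost_mul_source e
    | ghost_mul_edge_self e => simpa using hx.ghost_mul_edge_self e
    | ghost_mul_edge_of_ne e f h => simpa using hx.ghost_mul_edge_of_ne e f h
    | vertex_eq_sum v h => simpa using hx.vertex_eq_sum v h⟩

theorem lift_gen {A : Type*} [Ring A] [Algebra K A] (x : LeavittGen V → A)
    (hx : IsLeavittFamily V x) (g : LeavittGen V) : lift (K := K) x hx (gen K V g) = x g := by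
  simp [lift, gen]

variable (K)

/-- The element `p = e_1 ⋯ e_n` of `L_K(E)` given by a path `p`; a path of length `0` is a
vertex. -/
noncomputable def path {a : V} : {b : V} → Quiver.Path a b → LeavittPathAlgebra K V
  | _, .nil => vertex K V a
  | _, .cons p e => path p * edge K V ⟨_, _, e⟩

/-- The element `p^* = e_n^* ⋯ e_1^*` of `L_K(E)` given by a path `p`. -/
noncomputable def pathStar {a : V} : {b : V} → Quiver.Path a b → LeavittPathAlgebra K V
  | _, .nil => vertex K V a
  | _, .cons p e => ghost K V ⟨_, _, e⟩ * pathStar p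

variable (V)

/-- The component `L_K(E)_n` of the canonical `ℤ`-grading: the linear span of the elements `p q^*`,
where `p`, `q` are paths with common range and `length p - length q = n`. -/
noncomputable def deg (n : ℤ) : Submodule K (LeavittPathAlgebra K V) :=
  Submodule.span K {x | ∃ (a b c : V) (p : Quiver.Path a c) (q : Quiver.Path b c),
    (p.length : ℤ) - (q.length : ℤ) = n ∧ x = path K p * pathStar K q}

variable {K V}

/-- The images of the generators under `θ_{u,z}`. -/
noncomputable def thetaGen (u z : (LeavittPathAlgebra K V)ˣ) :
    LeavittGen V → LeavittPathAlgebra K V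
  | .vertex v => u * vertex K V v * ↑u⁻¹
  | .edge e => (u * edge K V e * ↑u⁻¹) * z
  | .ghost e => ↑z⁻¹ * (u * ghost K V e * ↑u⁻¹)

theorem isLeavittFamily_thetaGen (u z : (LeavittPathAlgebra K V)ˣ)
    (h : ∀ v : V, (z : LeavittPathAlgebra K V) * (u * vertex K V v * ↑u⁻¹) =
      (u * vertex K V v * ↑u⁻¹) * z) : IsLeavittFamily V (thetaGen u z) := by
  have H := isLeavittFamily_gen K V
  have conj : ∀ a b : LeavittPathAlgebra K V,
      (u * a * ↑u⁻¹) * (u * b * ↑u⁻¹) = u * (a * b) * ↑u⁻¹ := fun a b => by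
    simp [mul_assoc]
  have h' : ∀ v : V, (↑z⁻¹ : LeavittPathAlgebra K V) * (u * vertex K V v * ↑u⁻¹) =
      (u * vertex K V v * ↑u⁻¹) * ↑z⁻¹ := fun v =>
    (show Commute (z : LeavittPathAlgebra K V) _ from h v).units_inv_left
  refine ⟨?_, ?_, ?_, ?_, ?_, ?_, ?_, ?_, ?_, ?_⟩
  · intro v
    simp only [thetaGen, conj, H.vertex_mul_self]
  · intro v w hvw
    simp only [thetaGen, conj, H.vertex_mul_vertex_of_ne v w hvw, mul_zero, zero_mul]
  · simp only [thetaGen, ← Finset.mul_sum, ← Finset.sum_mul, H.sum_vertex, mul_one,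
      Units.mul_inv]
  · intro e
    simp only [thetaGen]
    rw [← mul_assoc, conj, H.source_mul_edge]
  · intro e
    simp only [thetaGen]
    rw [mul_assoc, h, ← mul_assoc, conj, H.edge_mul_range]
  · intro e
    simp only [thetaGen]
    rw [← mul_assoc, ← h', mul_assoc, conj, H.range_mul_ghost]
  · intro e
    simp only [thetaGen]
    rw [mul_assoc, conj, H.ghost_mul_source]
  · intro e
    simp only [thetaGen]
    rw [mul_assoc, ← mul_assoc (u * ghost K V e * ↑u⁻¹), conj, H.ghost_mul_edge_self, ← h,
      Units.inv_mul_cancel_left]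
  · intro e f hef
    simp only [thetaGen]
    rw [mul_assoc, ← mul_assoc (u * ghost K V e * ↑u⁻¹), conj, H.ghost_mul_edge_of_ne e f hef]
    simp
  · intro v hv
    have : ∀ e : Quiver.Total V, thetaGen u z (.edge e) * thetaGen u z (.ghost e) =
        u * (edge K V e * ghost K V e) * ↑u⁻¹ := fun e => by
      simp only [thetaGen]
      rw [mul_assoc, Units.mul_inv_cancel_left, conj]
    simp only [this, ← Finset.mul_sum, ← Finset.sum_mul]
    rw [← H.vertex_eq_sum v hv]
    rfl

/-- The algebra endomorphism `θ_{u,z}` of `L_K(E)`, given by `v ↦ u v u⁻¹`,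
`e ↦ (u e u⁻¹) z` and `e^* ↦ z⁻¹ (u e^* u⁻¹)`. -/
noncomputable def theta (u z : (LeavittPathAlgebra K V)ˣ)
    (h : ∀ v : V, (z : LeavittPathAlgebra K V) * (u * vertex K V v * ↑u⁻¹) =
      (u * vertex K V v * ↑u⁻¹) * z) :
    LeavittPathAlgebra K V →ₐ[K] LeavittPathAlgebra K V :=
  lift (thetaGen u z) (isLeavittFamily_thetaGen u z h)

end LeavittPathAlgebra

end Leavitt

/-! ## The graded Grothendieck group of a `ℤ`-graded algebra -/

section GradedK

universe w

variable {K : Type*} [CommRing K] {A : Type*} [Ring A] [Algebra K A]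
  {B : Type*} [Ring B] [Algebra K B]

/-- A finitely generated graded projective right module, in `Type w`, over an algebra `A` with
homogeneous components `𝒜 n`. -/
structure GradedProj (𝒜 : ℤ → Submodule K A) where
  carrier : Type w
  [addCommGroup : AddCommGroup carrier]
  [module : Module Aᵐᵒᵖ carrier]
  gr : ℤ → AddSubgroup carrier
  isInternal : DirectSum.IsInternal gr
  smul_mem : ∀ ⦃i j : ℤ⦄ ⦃m : carrier⦄ ⦃a : A⦄, m ∈ gr i → a ∈ 𝒜 j →
    MulOpposite.op a • m ∈ gr (i + j)
  finite : Module.Finite Aᵐᵒᵖ carrier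
  projective : Module.Projective Aᵐᵒᵖ carrier

attribute [instance] GradedProj.addCommGroup GradedProj.module GradedProj.finite
  GradedProj.projective

theorem isInternal_prod {M N : Type*} [AddCommGroup M] [AddCommGroup N]
    {F : ℤ → AddSubgroup M} {G : ℤ → AddSubgroup N} (hF : DirectSum.IsInternal F)
    (hG : DirectSum.IsInternal G) : DirectSum.IsInternal fun n => (F n).prod (G n) := by
  classical
  set c := DirectSum.coeAddMonoidHom fun n => (F n).prod (G n) with hc
  constructor
  · rw [injective_iff_map_eq_zero]
    intro d hd
    let p : (DirectSum ℤ fun n => ((F n).prod (G n))) →+ DirectSum ℤ fun n => F n :=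
      DirectSum.map fun n =>
        { toFun := fun x => ⟨x.1.1, x.2.1⟩, map_zero' := rfl, map_add' := fun _ _ => rfl }
    let q : (DirectSum ℤ fun n => ((F n).prod (G n))) →+ DirectSum ℤ fun n => G n :=
      DirectSum.map fun n =>
        { toFun := fun x => ⟨x.1.2, x.2.2⟩, map_zero' := rfl, map_add' := fun _ _ => rfl }
    have hp : (DirectSum.coeAddMonoidHom F).comp p = (AddMonoidHom.fst M N).comp c := by
      ext n x
      simp [p, c]
    have hq : (DirectSum.coeAddMonoidHom G).comp q = (AddMonoidHom.snd M N).comp c := by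
      ext n x
      simp [q, c]
    have hp0 : p d = 0 := hF.1 (by
      have := DFunLike.congr_fun hp d
      rw [AddMonoidHom.comp_apply, AddMonoidHom.comp_apply, hd] at this
      simpa using this)
    have hq0 : q d = 0 := hG.1 (by
      have := DFunLike.congr_fun hq d
      rw [AddMonoidHom.comp_apply, AddMonoidHom.comp_apply, hd] at this
      simpa using this)
    ext n
    · have := congrArg (fun t => ((t n : F n) : M)) hp0
      simpa [p] using this
    · have := congrArg (fun t => ((t n : G n) : N)) hq0
      simpa [q] using this
  · rintro ⟨x, y⟩
    obtain ⟨d, rfl⟩ := hF.2 x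
    obtain ⟨d', rfl⟩ := hG.2 y
    let i : (DirectSum ℤ fun n => F n) →+ DirectSum ℤ fun n => ((F n).prod (G n)) :=
      DirectSum.map fun n =>
        { toFun := fun x => ⟨(x.1, 0), x.2, zero_mem _⟩
          map_zero' := rfl
          map_add' := fun _ _ => by ext <;> simp }
    let j : (DirectSum ℤ fun n => G n) →+ DirectSum ℤ fun n => ((F n).prod (G n)) :=
      DirectSum.map fun n =>
        { toFun := fun x => ⟨(0, x.1), zero_mem _, x.2⟩
          map_zero' := rfl
          map_add' := fun _ _ => by ext <;> simp }
    have hi : c.comp i = (AddMonoidHom.inl M N).comp (DirectSum.coeAddMonoidHom F) := by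
      refine DirectSum.addHom_ext fun n x => ?_
      simp [i, c]
    have hj : c.comp j = (AddMonoidHom.inr M N).comp (DirectSum.coeAddMonoidHom G) := by
      refine DirectSum.addHom_ext fun n x => ?_
      simp [j, c]
    refine ⟨i d + j d', ?_⟩
    have h1 := DFunLike.congr_fun hi d
    have h2 := DFunLike.congr_fun hj d'
    simp only [AddMonoidHom.comp_apply] at h1 h2
    rw [map_add, h1, h2]
    simp

theorem isInternal_of_subsingleton {M : Type*} [AddCommGroup M] [Subsingleton M]
    (F : ℤ → AddSubgroup M) : DirectSum.IsInternal F := by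
  refine ⟨fun a b _ => ?_, fun x => ⟨0, Subsingleton.elim _ _⟩⟩
  ext n
  exact Subsingleton.elim _ _

namespace GradedProj

variable {𝒜 : ℤ → Submodule K A} {ℬ : ℤ → Submodule K B}

/-- Graded isomorphism (of degree `0`) of graded modules. -/
def Iso (P Q : GradedProj.{w} 𝒜) : Prop :=
  ∃ f : P.carrier ≃ₗ[Aᵐᵒᵖ] Q.carrier, ∀ n x, x ∈ P.gr n ↔ f x ∈ Q.gr n

/-- The setoid of graded isomorphism. -/
instance setoid (𝒜 : ℤ → Submodule K A) : Setoid (GradedProj.{w} 𝒜) where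
  r := Iso
  iseqv :=
    { refl := fun _ => ⟨LinearEquiv.refl _ _, fun _ _ => Iff.rfl⟩
      symm := fun ⟨f, hf⟩ => ⟨f.symm, fun n x => by simpa using (hf n (f.symm x)).symm⟩
      trans := fun ⟨f, hf⟩ ⟨g, hg⟩ => ⟨f.trans g, fun n x => (hf n x).trans (hg n (f x))⟩ }

/-- The zero graded module. -/
def zero (𝒜 : ℤ → Submodule K A) : GradedProj.{w} 𝒜 where
  carrier := PUnit.{w + 1}
  gr _ := ⊤
  isInternal := isInternal_of_subsingleton _
  smul_mem _ _ _ _ _ _ := AddSubgroup.mem_top _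
  finite := inferInstance
  projective := inferInstance

/-- The direct sum of two graded modules. -/
def sum (P Q : GradedProj.{w} 𝒜) : GradedProj.{w} 𝒜 where
  carrier := P.carrier × Q.carrier
  gr n := (P.gr n).prod (Q.gr n)
  isInternal := isInternal_prod P.isInternal Q.isInternal
  smul_mem _ _ _ _ hm ha := ⟨P.smul_mem hm.1 ha, Q.smul_mem hm.2 ha⟩
  finite := inferInstance
  projective := inferInstance

/-- An algebra isomorphism is graded if it matches the homogeneous components. -/
def _root_.AlgEquiv.IsGraded (φ : A ≃ₐ[K] B) (𝒜 : ℤ → Submodule K A)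
    (ℬ : ℤ → Submodule K B) : Prop :=
  ∀ n a, a ∈ 𝒜 n ↔ φ a ∈ ℬ n

/-- The graded equivalence `Gr-A → Gr-B` induced by a graded isomorphism `φ : A → B`, on finitely
generated projective modules: a graded `A`-module `P` becomes a graded `B`-module with the same
homogeneous components by `x · b = x · φ⁻¹(b)`. (The map `x ↦ x ⊗ 1` is an isomorphism from this
module to `P ⊗_A B`.) -/
def transport (φ : A ≃ₐ[K] B) (hφ : φ.IsGraded 𝒜 ℬ) (P : GradedProj.{w} 𝒜) :
    GradedProj.{w} ℬ :=
  letI : Module Bᵐᵒᵖ P.carrier :=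
    Module.compHom P.carrier (RingEquiv.op φ.symm.toRingEquiv : Bᵐᵒᵖ →+* Aᵐᵒᵖ)
  { carrier := P.carrier
    gr := P.gr
    isInternal := P.isInternal
    smul_mem := fun i j m b hm hb => P.smul_mem (a := φ.symm b) hm ((hφ j _).2 (by simpa using hb))
    finite := by
      let e := RingEquiv.op φ.symm.toRingEquiv
      have : RingHomSurjective (e.symm : Aᵐᵒᵖ →+* Bᵐᵒᵖ) := ⟨e.symm.surjective⟩
      let f : P.carrier →ₛₗ[(e.symm : Aᵐᵒᵖ →+* Bᵐᵒᵖ)] P.carrier :=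
        { toFun := id, map_add' := fun _ _ => rfl, map_smul' := fun a x => by
            change a • x = e (e.symm a) • x
            rw [e.apply_symm_apply] }
      exact Module.Finite.of_surjective f Function.surjective_id
    projective := by
      let e := RingEquiv.op φ.symm.toRingEquiv
      let := RingHomInvPair.of_ringEquiv e
      let := RingHomInvPair.symm (e : Bᵐᵒᵖ →+* Aᵐᵒᵖ) (e.symm : Aᵐᵒᵖ →+* Bᵐᵒᵖ)
      let f : P.carrier ≃ₛₗ[(e.symm : Aᵐᵒᵖ →+* Bᵐᵒᵖ)] P.carrier :=
        { toFun := id, invFun := id, left_inv := fun _ => rfl, right_inv := fun _ => rfl,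
          map_add' := fun _ _ => rfl, map_smul' := fun a x => by
            change a • x = e (e.symm a) • x
            rw [e.apply_symm_apply] }
      exact Module.Projective.of_equiv f }

end GradedProj

open GradedProj

/-- The monoid of graded isomorphism classes of finitely generated graded projective right
modules. -/
def Vgr (𝒜 : ℤ → Submodule K A) := Quotient (GradedProj.setoid.{w} 𝒜)

variable {𝒜 : ℤ → Submodule K A} {ℬ : ℤ → Submodule K B}

instance : Zero (Vgr.{w} 𝒜) := ⟨⟦GradedProj.zero 𝒜⟧⟩

instance : Add (Vgr.{w} 𝒜) :=
  ⟨Quotient.map₂ GradedProj.sum (by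
    rintro P P' ⟨f, hf⟩ Q Q' ⟨g, hg⟩
    exact ⟨f.prodCongr g, fun n x => and_congr (hf n x.1) (hg n x.2)⟩)⟩

instance : AddCommMonoid (Vgr.{w} 𝒜) where
  add_assoc := by
    rintro ⟨P⟩ ⟨Q⟩ ⟨R⟩
    exact Quotient.sound ⟨LinearEquiv.prodAssoc _ _ _ _, fun n x => and_assoc⟩
  zero_add := by
    rintro ⟨P⟩
    refine Quotient.sound ⟨LinearEquiv.uniqueProd (R := Aᵐᵒᵖ) (M := P.carrier) (M₂ := PUnit.{w + 1}), fun n x => ?_⟩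
    exact ⟨fun h => h.2, fun h => ⟨AddSubgroup.mem_top _, h⟩⟩
  add_zero := by
    rintro ⟨P⟩
    refine Quotient.sound ⟨LinearEquiv.prodUnique (R := Aᵐᵒᵖ) (M := P.carrier) (M₂ := PUnit.{w + 1}), fun n x => ?_⟩
    exact ⟨fun h => h.1, fun h => ⟨h, AddSubgroup.mem_top _⟩⟩
  add_comm := by
    rintro ⟨P⟩ ⟨Q⟩
    exact Quotient.sound ⟨LinearEquiv.prodComm _ _ _, fun n x => and_comm⟩
  nsmul := nsmulRec

/-- The graded Grothendieck group `K_0^gr(A)`. -/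
abbrev K0gr (𝒜 : ℤ → Submodule K A) := Algebra.GrothendieckAddGroup (Vgr.{w} 𝒜)

/-- The map on isomorphism classes induced by a graded isomorphism. -/
def Vgr.map (φ : A ≃ₐ[K] B) (hφ : φ.IsGraded 𝒜 ℬ) : Vgr.{w} 𝒜 →+ Vgr.{w} ℬ where
  toFun := Quotient.map (GradedProj.transport φ hφ) (by
    rintro P Q ⟨f, hf⟩
    exact ⟨{ toFun := f, invFun := f.symm, left_inv := f.left_inv, right_inv := f.right_inv,
             map_add' := f.map_add, map_smul' := fun b x => f.map_smul _ x }, hf⟩)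
  map_zero' := Quotient.sound ⟨
    { toFun := id, invFun := id, left_inv := fun _ => rfl, right_inv := fun _ => rfl,
      map_add' := fun _ _ => rfl, map_smul' := fun _ _ => rfl }, fun _ _ => Iff.rfl⟩
  map_add' := by
    rintro ⟨P⟩ ⟨Q⟩
    exact Quotient.sound ⟨
      { toFun := id, invFun := id, left_inv := fun _ => rfl, right_inv := fun _ => rfl,
        map_add' := fun _ _ => rfl, map_smul' := fun _ _ => rfl }, fun _ _ => Iff.rfl⟩

/-- The map `K_0^gr(φ) : K_0^gr(A) → K_0^gr(B)` induced by a graded isomorphism `φ : A → B`. -/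
noncomputable def K0gr.map (φ : A ≃ₐ[K] B) (hφ : φ.IsGraded 𝒜 ℬ) : K0gr.{w} 𝒜 →+ K0gr.{w} ℬ :=
  Algebra.GrothendieckAddGroup.lift
    (Algebra.GrothendieckAddGroup.of.comp (Vgr.map.{w} φ hφ))

end GradedK

universe k v₁ e₁ v₂ e₂

/-! Write `B` for the Leavitt path algebra of `F` and put `α = ψ ∘ φ⁻¹`, a graded automorphism of
`B`. The task is to show `α = θ_{u,z}`.

For an idempotent `e` of degree `0`, equality of the two maps on `K_0^gr` says only that the graded
modules `eB` and `eB` twisted by `α` become isomorphic after adding some `Q`. The main point is that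
`Q` cancels (`GradedProj.Iso.cancel_right`). By Evans' argument this follows once the ring of
degree-`0` endomorphisms of `Q` has stable range one. That ring need not be finite-dimensional, but
finitely many of its elements always lie in a common finite-dimensional subalgebra. On homogeneous
generators an endomorphism is a matrix of homogeneous elements, and bounding path lengths by
`truncDeg` gives finite-dimensional spaces that compose like matrix blocks. Finite-dimensional
algebras are artinian, hence semiprimary, and so have stable range one by Wedderburn–Artin and
lifting of units modulo the nilpotent radical.

After cancellation, an isomorphism from `eB` to its twist is encoded by `x`, `y` of degree `0` with
`xy = e` and `yx = α(e)` (`exists_equivalence_of_K0gr_map_eq`). For `e` running over the vertices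
these add up to a unit `u` with `u⁻¹ α(v) u = v` (`exists_unit_conj_vertex`).

The generators and their images under `u⁻¹ α(·) u` are then two Leavitt families with the same
vertices. They differ by a unit `d` of degree `0` commuting with the vertices: the second family has
edges `d e` and ghost edges `e^* d⁻¹` (`leavittTransition`). Hence `α = θ_{ud, u d u⁻¹}`. -/

/-! ## Stable range one -/

/-- A ring has stable range one if every unimodular row of length two can be shortened. -/
def HasStableRangeOne (R : Type*) [Ring R] : Prop :=
  ∀ a b x : R, a * x + b = 1 → ∃ y, IsUnit (a + b * y)

theorem HasStableRangeOne.of_ringEquiv {R S : Type*} [Ring R] [Ring S] (e : R ≃+* S)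
    (h : HasStableRangeOne S) : HasStableRangeOne R := by
  intro a b x hx
  obtain ⟨y, hy⟩ := h (e a) (e b) (e x) (by rw [← map_mul, ← map_add, hx, map_one])
  refine ⟨e.symm y, ?_⟩
  have := hy.map e.symm
  simpa using this

theorem HasStableRangeOne.pi {ι : Type*} {R : ι → Type*} [∀ i, Ring (R i)]
    (h : ∀ i, HasStableRangeOne (R i)) : HasStableRangeOne (∀ i, R i) := by
  intro a b x hx
  choose y hy using fun i => h i (a i) (b i) (x i) (congrFun hx i)
  exact ⟨y, Pi.isUnit_iff.2 hy⟩

/-- If `a x + b = 1` for endomorphisms of a finite-dimensional vector space, then a suitable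
correction of `a` by a multiple of `b` is invertible. -/
theorem hasStableRangeOne_end {D V : Type*} [DivisionRing D] [AddCommGroup V] [Module D V]
    [Module.Finite D V] : HasStableRangeOne (Module.End D V) := by
  intro a b x hx
  have hsup : ∀ v, v ∈ LinearMap.range a ⊔ LinearMap.range b := fun v => by
    rw [← Module.End.one_apply (R := D) v, ← hx, LinearMap.add_apply]
    exact add_mem (Submodule.mem_sup_left ⟨x v, rfl⟩) (Submodule.mem_sup_right ⟨v, rfl⟩)
  obtain ⟨C, hC⟩ := Submodule.exists_isCompl (LinearMap.ker a)
  let q := (LinearMap.range a).mkQ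
  have hq : LinearMap.range (q ∘ₗ b) = ⊤ := by
    refine eq_top_iff.2 fun z _ => ?_
    obtain ⟨v, rfl⟩ := Submodule.mkQ_surjective _ z
    obtain ⟨y, hy, z, ⟨w, rfl⟩, rfl⟩ := Submodule.mem_sup.1 (hsup v)
    refine ⟨w, ?_⟩
    simp [q, (Submodule.Quotient.mk_eq_zero _).2 hy]
  obtain ⟨g, hg⟩ := (q ∘ₗ b).exists_rightInverse_of_surjective hq
  have hdim : Module.finrank D (LinearMap.ker a) =
      Module.finrank D (V ⧸ LinearMap.range a) := by
    have h1 := a.finrank_range_add_finrank_ker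
    have h2 := (LinearMap.range a).finrank_quotient_add_finrank
    omega
  let σ := LinearEquiv.ofFinrankEq _ _ hdim
  -- `y` kills the complement `C`, and `b * y` carries `ker a` isomorphically onto a complement of
  -- `range a`. So `b * y` supplies exactly what `a` misses.
  let y : Module.End D V := g ∘ₗ σ.toLinearMap ∘ₗ Submodule.projectionOnto _ _ hC
  refine ⟨y, (Module.End.isUnit_iff _).2 ?_⟩
  have hinj : Function.Injective (a + b * y) := by
    rw [injective_iff_map_eq_zero]
    intro v hv
    have hv' : q (b (y v)) = 0 := by
      have : q (a v + b (y v)) = 0 := by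
        rw [show a v + b (y v) = 0 from hv, map_zero]
      rwa [map_add, show q (a v) = 0 from
        (Submodule.Quotient.mk_eq_zero _).2 (LinearMap.mem_range_self a v), zero_add] at this
    have h3 : Submodule.projectionOnto _ _ hC v = 0 := by
      have h4 := LinearMap.congr_fun hg (σ (Submodule.projectionOnto _ _ hC v))
      simp only [LinearMap.comp_apply, LinearMap.id_apply] at h4
      have h5 : σ (Submodule.projectionOnto _ _ hC v) = 0 := h4.symm.trans hv'
      simpa using h5
    have hy0 : y v = 0 := by simp [y, h3]
    have hav : a v = 0 := by
      have : a v + b (y v) = 0 := hv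
      simpa [hy0] using this
    have := Submodule.projectionOnto_apply_left hC ⟨v, hav⟩
    rw [h3] at this
    exact (congrArg Subtype.val this).symm
  exact ⟨hinj, LinearMap.injective_iff_surjective.1 hinj⟩

/-- A ring is free of rank one as a right module over itself. -/
def opLinearEquivSelf (R : Type*) [Ring R] : Rᵐᵒᵖ ≃ₗ[Rᵐᵒᵖ] R where
  toFun := MulOpposite.unop
  invFun := MulOpposite.op
  map_add' _ _ := rfl
  map_smul' _ _ := rfl
  left_inv _ := rfl
  right_inv _ := rfl

instance finite_op_self (R : Type*) [Ring R] : Module.Finite Rᵐᵒᵖ R :=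
  .equiv (opLinearEquivSelf R)

/-- By Wedderburn–Artin the ring is a finite product of matrix rings over division rings, and each
factor is the endomorphism ring of a finite-dimensional space over the opposite division ring. -/
theorem hasStableRangeOne_of_isSemisimpleRing (R : Type*) [Ring R] [IsSemisimpleRing R] :
    HasStableRangeOne R := by
  obtain ⟨n, D, d, hD, -, ⟨e⟩⟩ := IsSemisimpleRing.exists_ringEquiv_pi_matrix_divisionRing R
  refine .of_ringEquiv e (.pi fun i => ?_)
  refine .of_ringEquiv (RingEquiv.mapMatrix (RingEquiv.moduleEndSelfOp (D i))) ?_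
  exact .of_ringEquiv (endVecRingEquivMatrixEnd (Fin (d i)) (D i)ᵐᵒᵖ (D i)).symm
    hasStableRangeOne_end

/-- The quotient by the Jacobson radical is semisimple, and the radical is nilpotent. An element
that is invertible modulo the radical is therefore invertible, so a solution in the quotient lifts.
-/
theorem hasStableRangeOne_of_isSemiprimaryRing (R : Type*) [Ring R] [IsSemiprimaryRing R] :
    HasStableRangeOne R := by
  intro a b x hx
  let π := Ideal.Quotient.mk (Ring.jacobson R)
  obtain ⟨y, hy⟩ := hasStableRangeOne_of_isSemisimpleRing (R ⧸ Ring.jacobson R) (π a) (π b) (π x)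
    (by rw [← map_mul, ← map_add, hx, map_one])
  obtain ⟨y, rfl⟩ := Ideal.Quotient.mk_surjective y
  refine ⟨y, ?_⟩
  have lift : ∀ r : R, π r = 1 → IsUnit r := fun r hr => by
    obtain ⟨n, hn⟩ := IsSemiprimaryRing.isNilpotent (R := R)
    have h1 : r - 1 ∈ Ring.jacobson R := by
      rw [← Ideal.Quotient.eq_zero_iff_mem]
      simpa [sub_eq_zero] using hr
    have h2 : IsNilpotent (r - 1) := ⟨n, by
      have := Ideal.pow_mem_pow h1 n
      rw [hn] at this
      simpa using this⟩
    simpa using h2.isUnit_one_add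
  rw [show Ideal.Quotient.mk (Ring.jacobson R) y = π y from rfl, ← map_mul, ← map_add] at hy
  obtain ⟨w, hw1, hw2⟩ := isUnit_iff_exists.1 hy
  obtain ⟨w, rfl⟩ := Ideal.Quotient.mk_surjective w
  have h1 := lift ((a + b * y) * w) (by rw [map_mul]; exact hw1)
  have h2 := lift (w * (a + b * y)) (by rw [map_mul]; exact hw2)
  obtain ⟨s, hs⟩ := h1.exists_right_inv
  obtain ⟨t, ht⟩ := h2.exists_left_inv
  refine isUnit_iff_exists_and_exists.2 ⟨⟨w * s, ?_⟩, ⟨t * w, ?_⟩⟩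
  · rw [← mul_assoc, hs]
  · rw [mul_assoc, ht]

theorem hasStableRangeOne_of_finiteDimensional (K R : Type*) [Field K] [Ring R] [Algebra K R]
    [Module.Finite K R] : HasStableRangeOne R :=
  have : IsArtinianRing R := isArtinian_of_tower K inferInstance
  hasStableRangeOne_of_isSemiprimaryRing R

/-! ## The grading of a Leavitt path algebra -/

namespace LeavittPathAlgebra

section Grading

variable (K : Type*) [Field K] (V : Type*) [Quiver V] [Fintype V] [Fintype (Quiver.Total V)]

theorem vertex_mul_path {a b : V} (p : Quiver.Path a b) : vertex K V a * path K p = path K p := by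
  induction p with
  | nil => exact (isLeavittFamily_gen K V).vertex_mul_self a
  | cons p e ih => rw [path, ← mul_assoc, ih]

theorem path_mul_vertex {a b : V} (p : Quiver.Path a b) : path K p * vertex K V b = path K p := by
  cases p with
  | nil => exact (isLeavittFamily_gen K V).vertex_mul_self a
  | cons p e => rw [path, mul_assoc, (isLeavittFamily_gen K V).edge_mul_range ⟨_, _, e⟩]

theorem vertex_mul_pathStar {a b : V} (p : Quiver.Path a b) :
    vertex K V b * pathStar K p = pathStar K p := by
  cases p with
  | nil => exact (isLeavittFamily_gen K V).vertex_mul_self a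
  | cons p e => rw [pathStar, ← mul_assoc, (isLeavittFamily_gen K V).range_mul_ghost ⟨_, _, e⟩]

theorem path_comp {a b c : V} (p : Quiver.Path a b) (q : Quiver.Path b c) :
    path K (p.comp q) = path K p * path K q := by
  induction q with
  | nil => exact (path_mul_vertex K V p).symm
  | cons q e ih => rw [Quiver.Path.comp_cons, path, path, ih, mul_assoc]

theorem pathStar_comp {a b c : V} (p : Quiver.Path a b) (q : Quiver.Path b c) :
    pathStar K (p.comp q) = pathStar K q * pathStar K p := by
  induction q with
  | nil => exact (vertex_mul_pathStar K V p).symm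
  | cons q e ih => rw [Quiver.Path.comp_cons, pathStar, pathStar, ih, mul_assoc]

theorem path_mul_path_of_ne {a b c d : V} (p : Quiver.Path a b) (q : Quiver.Path c d)
    (h : b ≠ c) : path K p * path K q = 0 := by
  rw [← path_mul_vertex, ← vertex_mul_path K V q, mul_assoc, ← mul_assoc (vertex K V b),
    (isLeavittFamily_gen K V).vertex_mul_vertex_of_ne b c h, zero_mul, mul_zero]

/-- The product `e^* p` is zero, or `p` is a vertex, or `p` starts with `e`. -/
theorem ghost_mul_path {x y : V} (e : x ⟶ y) {a b : V} (p : Quiver.Path a b) :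
    ghost K V ⟨_, _, e⟩ * path K p = 0 ∨
    (b = x ∧ p.length = 0 ∧ ghost K V ⟨_, _, e⟩ * path K p = ghost K V ⟨_, _, e⟩) ∨
    ∃ t : Quiver.Path y b, p.length = t.length + 1 ∧
      ghost K V ⟨_, _, e⟩ * path K p = path K t := by
  have H := isLeavittFamily_gen K V
  induction p with
  | nil =>
    by_cases h : a = x
    · subst h
      exact .inr (.inl ⟨rfl, rfl, H.ghost_mul_source ⟨_, _, e⟩⟩)
    · left
      rw [path, ← show ghost K V ⟨_, _, e⟩ * vertex K V x = ghost K V ⟨_, _, e⟩ from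
        H.ghost_mul_source ⟨_, _, e⟩, mul_assoc, H.vertex_mul_vertex_of_ne _ _ (Ne.symm h),
        mul_zero]
  | @cons b c p f ih =>
    rw [path, ← mul_assoc]
    rcases ih with h | ⟨rfl, h0, h⟩ | ⟨t, ht, h⟩
    · left
      rw [h, zero_mul]
    · rw [h]
      by_cases hef : (⟨_, _, e⟩ : Quiver.Total V) = ⟨_, _, f⟩
      · right; right
        cases hef
        exact ⟨.nil, by simp [h0], H.ghost_mul_edge_self _⟩
      · left
        exact H.ghost_mul_edge_of_ne _ _ hef
    · right; right
      exact ⟨t.cons f, by simp [ht], by rw [h, path]⟩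

/-- The product `q^* p` is zero, or `p` extends `q`, or `q` extends `p`. -/
theorem pathStar_mul_path {a b c d : V} (q : Quiver.Path a b) (p : Quiver.Path c d) :
    pathStar K q * path K p = 0 ∨
    (∃ t : Quiver.Path b d, p.length = q.length + t.length ∧
      pathStar K q * path K p = path K t) ∨
    ∃ t : Quiver.Path d b, q.length = p.length + t.length ∧
      pathStar K q * path K p = pathStar K t := by
  have H := isLeavittFamily_gen K V
  induction q with
  | nil =>
    by_cases h : a = c
    · subst h
      exact .inr (.inl ⟨p, by simp, vertex_mul_path K V p⟩)
    · exact .inl (path_mul_path_of_ne K V .nil p h)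
  | @cons b x q f ih =>
    rw [pathStar, mul_assoc]
    rcases ih with h | ⟨t, ht, h⟩ | ⟨t, ht, h⟩
    · left
      rw [h, mul_zero]
    · rw [h]
      rcases ghost_mul_path K V f t with h' | ⟨rfl, h0, h'⟩ | ⟨t', ht', h'⟩
      · exact .inl h'
      · refine .inr (.inr ⟨Quiver.Hom.toPath f, by simp [ht, h0], ?_⟩)
        rw [h']
        exact (H.ghost_mul_source _).symm
      · refine .inr (.inl ⟨t', ?_, h'⟩)
        rw [ht, ht', Quiver.Path.length_cons]
        omega
    · right; right
      refine ⟨t.cons f, ?_, by rw [h, pathStar]⟩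
      simp [ht, add_assoc]

/-- The span of the elements `p q^*` with `length p ≤ m`, `length q ≤ n` and
`length p - length q = m - n`. -/
noncomputable def truncDeg (m n : ℤ) : Submodule K (LeavittPathAlgebra K V) :=
  Submodule.span K {x | ∃ (a b c : V) (p : Quiver.Path a c) (q : Quiver.Path b c),
    (p.length : ℤ) ≤ m ∧ (q.length : ℤ) ≤ n ∧ (p.length : ℤ) - q.length = m - n ∧
      x = path K p * pathStar K q}

/-- The common index `m` bounds the lengths of both inner paths. In `p q^* p' q'^*` the factor `q^*
p'` collapses to some `t` or `t^*`. If `p' = q t`, then `|pt| = (|p| - |q|) + |p'| ≤ (l - m) + m =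
l`; the other case is symmetric. -/
theorem truncDeg_mul_mem {l m n : ℤ} {x y : LeavittPathAlgebra K V} (hx : x ∈ truncDeg K V l m)
    (hy : y ∈ truncDeg K V m n) : x * y ∈ truncDeg K V l n := by
  induction hx, hy using Submodule.span_induction₂ with
  | mem_mem x y hx hy =>
    obtain ⟨a, b, c, p, q, hp, hq, hpq, rfl⟩ := hx
    obtain ⟨a', b', c', p', q', hp', hq', hpq', rfl⟩ := hy
    rw [mul_assoc, ← mul_assoc (pathStar K q)]
    rcases pathStar_mul_path K V q p' with h | ⟨t, ht, h⟩ | ⟨t, ht, h⟩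
    · simp [h]
    · rw [h, ← mul_assoc, ← path_comp]
      refine Submodule.subset_span ⟨_, _, _, p.comp t, q', ?_, hq', ?_, rfl⟩ <;>
        rw [Quiver.Path.length_comp] <;> push_cast <;> omega
    · rw [h, ← pathStar_comp]
      refine Submodule.subset_span ⟨_, _, _, p, q'.comp t, hp, ?_, ?_, rfl⟩ <;>
        rw [Quiver.Path.length_comp] <;> push_cast <;> omega
  | zero_left y hy => simp
  | zero_right x hx => simp
  | add_left x y z _ _ _ h1 h2 => rw [add_mul]; exact add_mem h1 h2
  | add_right x y z _ _ _ h1 h2 => rw [mul_add]; exact add_mem h1 h2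
  | smul_left r x y _ _ h => rw [smul_mul_assoc]; exact Submodule.smul_mem _ _ h
  | smul_right r x y _ _ h => rw [mul_smul_comm]; exact Submodule.smul_mem _ _ h

theorem truncDeg_le_deg (m n d : ℤ) (h : m - n = d) : truncDeg K V m n ≤ deg K V d := by
  refine Submodule.span_mono ?_
  rintro x ⟨a, b, c, p, q, -, -, hpq, rfl⟩
  exact ⟨a, b, c, p, q, hpq.trans h, rfl⟩

/-- A finite linear combination involves paths of bounded length, so a homogeneous element lies in
every sufficiently high truncation of its degree. -/
theorem exists_mem_truncDeg {d : ℤ} {x : LeavittPathAlgebra K V} (hx : x ∈ deg K V d) :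
    ∃ N : ℤ, ∀ m n, N ≤ n → m - n = d → x ∈ truncDeg K V m n := by
  induction hx using Submodule.span_induction with
  | mem x hx =>
    obtain ⟨a, b, c, p, q, hpq, rfl⟩ := hx
    exact ⟨q.length, fun m n hn hmn => Submodule.subset_span
      ⟨a, b, c, p, q, by omega, by omega, by omega, rfl⟩⟩
  | zero => exact ⟨0, fun _ _ _ _ => zero_mem _⟩
  | add x y _ _ hx hy =>
    obtain ⟨N, hN⟩ := hx
    obtain ⟨M, hM⟩ := hy
    exact ⟨max N M, fun m n hn hmn => add_mem (hN m n ((le_max_left _ _).trans hn) hmn)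
      (hM m n ((le_max_right _ _).trans hn) hmn)⟩
  | smul r x _ hx =>
    obtain ⟨N, hN⟩ := hx
    exact ⟨N, fun m n hn hmn => Submodule.smul_mem _ _ (hN m n hn hmn)⟩

theorem vertex_mem_truncDeg (v : V) {n : ℤ} (hn : 0 ≤ n) : vertex K V v ∈ truncDeg K V n n :=
  Submodule.subset_span ⟨v, v, v, .nil, .nil, by simpa using hn, by simpa using hn, by simp,
    ((isLeavittFamily_gen K V).vertex_mul_self v).symm⟩

theorem one_mem_truncDeg {n : ℤ} (hn : 0 ≤ n) : 1 ∈ truncDeg K V n n := by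
  rw [← (isLeavittFamily_gen K V).sum_vertex]
  exact sum_mem fun v _ => vertex_mem_truncDeg K V v hn

open scoped Pointwise in
theorem finite_paths (n : ℕ) : {x : LeavittPathAlgebra K V | ∃ (a b : V) (p : Quiver.Path a b),
    p.length = n ∧ x = path K p}.Finite := by
  induction n with
  | zero =>
    refine (Set.finite_range (vertex K V)).subset ?_
    rintro x ⟨a, b, p, hp, rfl⟩
    obtain rfl := Quiver.Path.eq_of_length_zero p hp
    obtain rfl := Quiver.Path.eq_nil_of_length_zero p hp
    exact ⟨a, rfl⟩
  | succ n ih =>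
    refine (ih.mul (Set.finite_range (edge K V))).subset ?_
    rintro x ⟨a, b, p, hp, rfl⟩
    cases p with
    | nil => simp at hp
    | cons p e => exact Set.mul_mem_mul ⟨_, _, p, by simpa using hp, rfl⟩ ⟨_, rfl⟩

open scoped Pointwise in
theorem finite_pathStars (n : ℕ) :
    {x : LeavittPathAlgebra K V | ∃ (a b : V) (p : Quiver.Path a b),
      p.length = n ∧ x = pathStar K p}.Finite := by
  induction n with
  | zero =>
    refine (Set.finite_range (vertex K V)).subset ?_
    rintro x ⟨a, b, p, hp, rfl⟩
    obtain rfl := Quiver.Path.eq_of_length_zero p hp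
    obtain rfl := Quiver.Path.eq_nil_of_length_zero p hp
    exact ⟨a, rfl⟩
  | succ n ih =>
    refine ((Set.finite_range (ghost K V)).mul ih).subset ?_
    rintro x ⟨a, b, p, hp, rfl⟩
    cases p with
    | nil => simp at hp
    | cons p e => exact Set.mul_mem_mul ⟨_, rfl⟩ ⟨_, _, p, by simpa using hp, rfl⟩

-- A finite graph has finitely many paths of each length, hence finitely many products `p q^*`
-- within the bounds.
open scoped Pointwise in
instance finite_truncDeg (m n : ℤ) : Module.Finite K (truncDeg K V m n) := by
  have h := (Set.finite_iUnion fun i : Fin (m.toNat + 1) => finite_paths K V i).mul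
    (Set.finite_iUnion fun i : Fin (n.toNat + 1) => finite_pathStars K V i)
  have := FiniteDimensional.span_of_finite K h
  refine Submodule.finiteDimensional_of_le (S₂ := Submodule.span K
    ((⋃ i : Fin (m.toNat + 1), {x | ∃ (a b : V) (p : Quiver.Path a b),
      p.length = i ∧ x = path K p}) * ⋃ i : Fin (n.toNat + 1), {x | ∃ (a b : V)
      (p : Quiver.Path a b), p.length = i ∧ x = pathStar K p})) (Submodule.span_mono ?_)
  rintro x ⟨a, b, c, p, q, hp, hq, -, rfl⟩
  exact Set.mul_mem_mul (Set.mem_iUnion.2 ⟨⟨p.length, by omega⟩, _, _, p, rfl, rfl⟩)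
    (Set.mem_iUnion.2 ⟨⟨q.length, by omega⟩, _, _, q, rfl, rfl⟩)

theorem vertex_mem_deg (v : V) : vertex K V v ∈ deg K V 0 :=
  truncDeg_le_deg K V 0 0 0 rfl (vertex_mem_truncDeg K V v le_rfl)

theorem edge_mem_deg (e : Quiver.Total V) : edge K V e ∈ deg K V 1 :=
  Submodule.subset_span ⟨_, _, _, Quiver.Hom.toPath e.hom, .nil, by simp, by
    have H := isLeavittFamily_gen K V
    change edge K V e = (vertex K V e.left * edge K V e) * vertex K V e.right
    rw [H.source_mul_edge, H.edge_mul_range]⟩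

theorem ghost_mem_deg (e : Quiver.Total V) : ghost K V e ∈ deg K V (-1) :=
  Submodule.subset_span ⟨_, _, _, .nil, Quiver.Hom.toPath e.hom, by simp, by
    have H := isLeavittFamily_gen K V
    change ghost K V e = vertex K V e.right * (ghost K V e * vertex K V e.left)
    rw [H.ghost_mul_source, H.range_mul_ghost]⟩

instance gradedMonoid_deg : SetLike.GradedMonoid (deg K V) where
  one_mem := truncDeg_le_deg K V 0 0 0 rfl (one_mem_truncDeg K V le_rfl)
  mul_mem i j x y hx hy := by
    obtain ⟨N, hN⟩ := exists_mem_truncDeg K V hx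
    obtain ⟨M, hM⟩ := exists_mem_truncDeg K V hy
    -- The middle index `max N (j + M)` is at least `N`, as `x` requires, and remains at least `M`
    -- after subtracting `j`, as `y` requires.
    exact truncDeg_le_deg K V _ _ _ (by ring) (truncDeg_mul_mem K V
      (hN (i + max N (j + M)) (max N (j + M)) (le_max_left _ _) (by ring))
      (hM (max N (j + M)) (max N (j + M) - j) (by have := le_max_right N (j + M); omega) (by ring)))

variable {K V} in
/-- Algebra homomorphisms out of `L_K(E)` are determined by their values on the generators. -/
theorem algHom_ext {B : Type*} [Ring B] [Algebra K B] {f g : LeavittPathAlgebra K V →ₐ[K] B}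
    (h : ∀ x, f (gen K V x) = g (gen K V x)) : f = g := by
  refine RingQuot.ringQuot_ext' K f g (FreeAlgebra.hom_ext ?_)
  funext x
  exact h x

/-- The sum of the components is a subalgebra `S` containing the generators. The universal property
gives a map into `S` whose composite with the inclusion fixes the generators, so it is the identity
and `S` is everything. -/
theorem iSup_deg : ⨆ n, deg K V n = ⊤ := by
  let S : Subalgebra K (LeavittPathAlgebra K V) := Submodule.toSubalgebra (⨆ n, deg K V n)
    (Submodule.mem_iSup_of_mem 0 SetLike.GradedOne.one_mem) (fun x y hx hy => by
      induction hx using Submodule.iSup_induction' with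
      | zero => simp
      | add x x' _ _ h1 h2 => rw [add_mul]; exact add_mem h1 h2
      | mem i x hx =>
        induction hy using Submodule.iSup_induction' with
        | zero => simp
        | add x x' _ _ h1 h2 => rw [mul_add]; exact add_mem h1 h2
        | mem j y hy => exact Submodule.mem_iSup_of_mem (i + j) (SetLike.mul_mem_graded hx hy))
  have hS : ∀ x, gen K V x ∈ S
    | .vertex v => Submodule.mem_iSup_of_mem 0 (vertex_mem_deg K V v)
    | .edge e => Submodule.mem_iSup_of_mem 1 (edge_mem_deg K V e)
    | .ghost e => Submodule.mem_iSup_of_mem (-1) (ghost_mem_deg K V e)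
  let x' : LeavittGen V → S := fun x => ⟨gen K V x, hS x⟩
  have H := isLeavittFamily_gen K V
  have hx' : IsLeavittFamily V x' := by
    refine ⟨?_, ?_, ?_, ?_, ?_, ?_, ?_, ?_, ?_, ?_⟩
    · exact fun v => Subtype.ext (H.vertex_mul_self v)
    · exact fun v w h => Subtype.ext (H.vertex_mul_vertex_of_ne v w h)
    · exact Subtype.ext (by simpa [x'] using H.sum_vertex)
    · exact fun e => Subtype.ext (H.source_mul_edge e)
    · exact fun e => Subtype.ext (H.edge_mul_range e)
    · exact fun e => Subtype.ext (H.range_mul_ghost e)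
    · exact fun e => Subtype.ext (H.ghost_mul_source e)
    · exact fun e => Subtype.ext (H.ghost_mul_edge_self e)
    · exact fun e f h => Subtype.ext (H.ghost_mul_edge_of_ne e f h)
    · exact fun v h => Subtype.ext (by simpa [x'] using H.vertex_eq_sum v h)
  have key : S.val.comp (lift x' hx') = AlgHom.id K _ :=
    algHom_ext fun x => by simp [lift_gen, x']
  refine eq_top_iff.2 fun a _ => ?_
  have := DFunLike.congr_fun key a
  rw [AlgHom.id_apply] at this
  rw [← this]
  exact (lift x' hx' a).2

/-- The images of the generators under the coaction `x ↦ x T^n`, for `x` of degree `n`. -/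
noncomputable def coactionGen : LeavittGen V → AddMonoidAlgebra (LeavittPathAlgebra K V) ℤ
  | .vertex v => .single 0 (vertex K V v)
  | .edge e => .single 1 (edge K V e)
  | .ghost e => .single (-1) (ghost K V e)

theorem isLeavittFamily_coactionGen : IsLeavittFamily V (coactionGen K V) := by
  have H := isLeavittFamily_gen K V
  have hm : ∀ {m n k : ℤ} {a b c : LeavittPathAlgebra K V}, a * b = c → m + n = k →
      AddMonoidAlgebra.single m a * AddMonoidAlgebra.single n b = .single k c := by
    rintro m n k a b c rfl rfl
    exact AddMonoidAlgebra.single_mul_single ..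
  have h0 : ∀ n : ℤ, AddMonoidAlgebra.single n (0 : LeavittPathAlgebra K V) = 0 :=
    fun n => AddMonoidAlgebra.single_zero n
  refine ⟨?_, ?_, ?_, ?_, ?_, ?_, ?_, ?_, ?_, ?_⟩
  · exact fun v => hm (H.vertex_mul_self v) rfl
  · exact fun v w h => (hm (H.vertex_mul_vertex_of_ne v w h) rfl).trans (h0 _)
  · exact (map_sum (AddMonoidAlgebra.singleAddHom (0 : ℤ)) _ _).symm.trans
      (congrArg (AddMonoidAlgebra.single (0 : ℤ)) H.sum_vertex)
  · exact fun e => hm (H.source_mul_edge e) rfl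
  · exact fun e => hm (H.edge_mul_range e) rfl
  · exact fun e => hm (H.range_mul_ghost e) rfl
  · exact fun e => hm (H.ghost_mul_source e) rfl
  · exact fun e => hm (H.ghost_mul_edge_self e) rfl
  · exact fun e f h => (hm (H.ghost_mul_edge_of_ne e f h) rfl).trans (h0 _)
  · exact fun v h => (congrArg (AddMonoidAlgebra.single (0 : ℤ)) (H.vertex_eq_sum v h)).trans
      ((map_sum (AddMonoidAlgebra.singleAddHom (0 : ℤ)) _ _).trans
        (Finset.sum_congr rfl fun e _ => (hm (a := edge K V e) (b := ghost K V e) rfl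
          (add_neg_cancel 1)).symm))

/-- The coaction `L_K(E) → L_K(E)[T, T⁻¹]`, `x ↦ x T^n` for `x` of degree `n`. -/
noncomputable def coaction :
    LeavittPathAlgebra K V →ₐ[K] AddMonoidAlgebra (LeavittPathAlgebra K V) ℤ :=
  lift (coactionGen K V) (isLeavittFamily_coactionGen K V)

theorem coaction_gen (g : LeavittGen V) : coaction K V (gen K V g) = coactionGen K V g :=
  lift_gen _ _ g

theorem coaction_path {a b : V} (p : Quiver.Path a b) :
    coaction K V (path K p) = .single (p.length : ℤ) (path K p) := by
  induction p with
  | nil => exact coaction_gen K V _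
  | cons p e ih =>
    rw [path, map_mul, ih, coaction_gen, coactionGen, AddMonoidAlgebra.single_mul_single]
    rfl

theorem coaction_pathStar {a b : V} (p : Quiver.Path a b) :
    coaction K V (pathStar K p) = .single (-p.length : ℤ) (pathStar K p) := by
  induction p with
  | nil => exact coaction_gen K V _
  | cons p e ih =>
    rw [pathStar, map_mul, ih, coaction_gen, coactionGen, AddMonoidAlgebra.single_mul_single,
      Quiver.Path.length_cons, Nat.cast_add, Nat.cast_one, neg_add_rev]

variable {K V}

theorem coaction_of_mem_deg {n : ℤ} {x : LeavittPathAlgebra K V} (hx : x ∈ deg K V n) :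
    coaction K V x = .single n x := by
  induction hx using Submodule.span_induction with
  | mem x hx =>
    obtain ⟨a, b, c, p, q, rfl, rfl⟩ := hx
    rw [map_mul, coaction_path, coaction_pathStar, AddMonoidAlgebra.single_mul_single,
      sub_eq_add_neg]
  | zero => rw [map_zero, AddMonoidAlgebra.single_zero]
  | add x y _ _ hx hy => rw [map_add, hx, hy, AddMonoidAlgebra.single_add]
  | smul r x _ hx => rw [map_smul, hx, AddMonoidAlgebra.smul_single]

variable (K V)

/-- The coaction separates degrees: the coefficient of `T^n` in the image of a sum of homogeneous
elements is its component of degree `n`. So the components are determined by the sum. -/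
theorem isInternal_deg : DirectSum.IsInternal (deg K V) := by
  classical
  refine ⟨?_, ?_⟩
  · have h : ∀ d n, (coaction K V (DirectSum.coeAddMonoidHom (deg K V) d)).coeff n = d n := by
      intro d n
      induction d using DirectSum.induction_on with
      | zero => simp
      | of m x =>
        rw [DirectSum.coeAddMonoidHom_of, coaction_of_mem_deg x.2, DirectSum.coe_of_apply,
          AddMonoidAlgebra.coeff_single, Finsupp.single_apply]
        split_ifs <;> rfl
      | add x y hx hy => simp [hx, hy]
    intro d d' hd
    ext n
    rw [← h d, ← h d', hd]
  · rw [← AddMonoidHom.mrange_eq_top]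
    refine eq_top_iff.2 fun x _ => ?_
    have hx : x ∈ ⨆ n, deg K V n := by simp [iSup_deg]
    induction hx using Submodule.iSup_induction' with
    | zero => exact zero_mem _
    | add x y _ _ hx hy => exact add_mem (hx trivial) (hy trivial)
    | mem i x hx => exact ⟨DirectSum.of _ i ⟨x, hx⟩, DirectSum.coeAddMonoidHom_of _ i ⟨x, hx⟩⟩

end Grading
end LeavittPathAlgebra

/-! ## Cancellation of graded modules -/

section Cancellation

open LeavittPathAlgebra MulOpposite

variable {K : Type*} [Field K] {V : Type*} [Quiver V] [Fintype V] [Fintype (Quiver.Total V)]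
  {Q : Type*} [AddCommGroup Q] [Module (LeavittPathAlgebra K V)ᵐᵒᵖ Q] {gr : ℤ → AddSubgroup Q}

-- The homogeneous components of finitely many generators generate. Each is stored with its degree,
-- since the zero element has no well-defined one.
open scoped Classical in
theorem exists_homogeneous_generators [Module.Finite (LeavittPathAlgebra K V)ᵐᵒᵖ Q]
    (hgr : DirectSum.IsInternal gr) :
    ∃ (s : Finset (Q × ℤ)), (∀ i : s, i.1.1 ∈ gr i.1.2) ∧
      Submodule.span (LeavittPathAlgebra K V)ᵐᵒᵖ (Set.range fun i : s => i.1.1) = ⊤ := by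
  let := hgr.chooseDecomposition
  obtain ⟨t, ht⟩ := Module.Finite.fg_top (R := (LeavittPathAlgebra K V)ᵐᵒᵖ) (M := Q)
  refine ⟨t.biUnion fun y => (DirectSum.decompose gr y).support.image fun i =>
    ((DirectSum.decompose gr y i : Q), i), ?_, ?_⟩
  · rintro ⟨⟨x, n⟩, h⟩
    simp only [Finset.mem_biUnion, Finset.mem_image, Prod.mk.injEq] at h
    obtain ⟨y, -, i, -, rfl, rfl⟩ := h
    exact (DirectSum.decompose gr y i).2
  · rw [eq_top_iff, ← ht, Submodule.span_le]
    intro y hy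
    rw [← DirectSum.sum_support_decompose gr y]
    refine sum_mem fun i hi => Submodule.subset_span ⟨⟨(_, i), ?_⟩, rfl⟩
    exact Finset.mem_biUnion.2 ⟨y, hy, Finset.mem_image.2 ⟨i, hi, rfl⟩⟩

/-- Take arbitrary coefficients and pass to the component of degree `m`: only the part of degree `m
- n i` of the `i`-th coefficient survives. -/
theorem exists_homogeneous_coefficients (hgr : DirectSum.IsInternal gr)
    (hsmul : ∀ ⦃i j : ℤ⦄ ⦃m : Q⦄ ⦃a : LeavittPathAlgebra K V⦄, m ∈ gr i → a ∈ deg K V j →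
      op a • m ∈ gr (i + j)) {ι : Type*} [Fintype ι] {x : ι → Q} {n : ι → ℤ}
    (hx : ∀ i, x i ∈ gr (n i))
    (hspan : Submodule.span (LeavittPathAlgebra K V)ᵐᵒᵖ (Set.range x) = ⊤) {m : ℤ} {y : Q}
    (hy : y ∈ gr m) :
    ∃ H : ι → LeavittPathAlgebra K V, (∀ i, H i ∈ deg K V (m - n i)) ∧
      y = ∑ i, op (H i) • x i := by
  classical
  let := hgr.chooseDecomposition
  have key : ∀ (i : ι) (a : LeavittPathAlgebra K V), ∃ b ∈ deg K V (m - n i),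
      (DirectSum.decompose gr (op a • x i) m : Q) = op b • x i := by
    intro i a
    have ha : a ∈ ⨆ n, deg K V n := by rw [iSup_deg]; trivial
    induction ha using Submodule.iSup_induction' with
    | zero => exact ⟨0, zero_mem _, by simp⟩
    | add a b _ _ ha hb =>
      obtain ⟨a', ha', ha⟩ := ha
      obtain ⟨b', hb', hb⟩ := hb
      refine ⟨a' + b', add_mem ha' hb', ?_⟩
      rw [op_add, add_smul, DirectSum.decompose_add, DirectSum.add_apply, AddSubgroup.coe_add,
        ha, hb, op_add, add_smul]
    | mem k a ha =>
      have h := hsmul (hx i) ha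
      by_cases hk : n i + k = m
      · subst hk
        exact ⟨a, by simpa using ha, DirectSum.decompose_of_mem_same _ h⟩
      · exact ⟨0, zero_mem _, by rw [DirectSum.decompose_of_mem_ne _ h hk]; simp⟩
  obtain ⟨c, hc⟩ := (Submodule.mem_span_range_iff_exists_fun _).1
    (show y ∈ Submodule.span _ (Set.range x) by rw [hspan]; trivial)
  choose H hH hH' using fun i => key i (unop (c i))
  refine ⟨H, hH, ?_⟩
  rw [← DirectSum.decompose_of_mem_same gr hy, ← hc, DirectSum.decompose_sum,
    DFinsupp.finsetSum_apply, AddSubmonoidClass.coe_finsetSum]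
  exact Finset.sum_congr rfl fun i _ => hH' i

/-- The endomorphisms of degree `0` of a graded module. -/
def gradedEnd [Module K Q] [IsScalarTower K (LeavittPathAlgebra K V)ᵐᵒᵖ Q]
    (hK : ∀ n (k : K), ∀ x ∈ gr n, k • x ∈ gr n) :
    Subalgebra K (Module.End (LeavittPathAlgebra K V)ᵐᵒᵖ Q) where
  carrier := {h | ∀ n, ∀ x ∈ gr n, h x ∈ gr n}
  mul_mem' ha hb n x hx := ha n _ (hb n x hx)
  add_mem' ha hb n x hx := add_mem (ha n x hx) (hb n x hx)
  algebraMap_mem' k n x hx := hK n k x hx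

/-- The degree-`0` endomorphisms given on the generators `x` by matrices with entries in
`truncDeg`. -/
def truncEnd [Module K Q] [IsScalarTower K (LeavittPathAlgebra K V)ᵐᵒᵖ Q]
    {ι : Type*} [Fintype ι] (x : ι → Q) (n : ι → ℤ) (N : ℤ) (hN : ∀ i, n i ≤ N) :
    Subalgebra K (Module.End (LeavittPathAlgebra K V)ᵐᵒᵖ Q) where
  carrier := {h | ∃ H : ι → ι → LeavittPathAlgebra K V,
    (∀ i j, H i j ∈ truncDeg K V (N - n i) (N - n j)) ∧ ∀ j, h (x j) = ∑ i, op (H i j) • x i}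
  mul_mem' := by
    rintro a b ⟨H, hH, ha⟩ ⟨G, hG, hb⟩
    refine ⟨fun i j => ∑ l, H i l * G l j,
      fun i j => sum_mem fun l _ => truncDeg_mul_mem K V (hH i l) (hG l j), fun j => ?_⟩
    simp only [Module.End.mul_apply, hb, map_sum, map_smul, ha, Finset.smul_sum, Finset.op_sum,
      Finset.sum_smul, op_mul, mul_smul]
    exact Finset.sum_comm
  add_mem' := by
    rintro a b ⟨H, hH, ha⟩ ⟨G, hG, hb⟩
    refine ⟨fun i j => H i j + G i j, fun i j => add_mem (hH i j) (hG i j), fun j => ?_⟩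
    simp only [LinearMap.add_apply, ha, hb, op_add, add_smul, Finset.sum_add_distrib]
  algebraMap_mem' k := by
    classical
    -- Scalar matrices qualify because `n i ≤ N` places `1` in `truncDeg K V (N - n i) (N - n i)`.
    refine ⟨fun i j => if i = j then k • 1 else 0, fun i j => ?_, fun j => ?_⟩
    · dsimp only
      split_ifs with h
      · subst h
        exact Submodule.smul_mem _ _ (one_mem_truncDeg K V (by have := hN i; omega))
      · exact zero_mem _
    · rw [Finset.sum_eq_single j (fun i _ h => by simp [h]) (by simp)]
      dsimp only
      rw [if_pos rfl, op_smul, op_one,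
        smul_assoc, one_smul]
      rfl

/-- An endomorphism is determined by its values on the generators, and each value lies in the image
of a finite-dimensional space of coefficient columns. -/
theorem finite_truncEnd [Module K Q] [IsScalarTower K (LeavittPathAlgebra K V)ᵐᵒᵖ Q]
    {ι : Type*} [Fintype ι] {x : ι → Q} {n : ι → ℤ} {N : ℤ} (hN : ∀ i, n i ≤ N)
    (hspan : Submodule.span (LeavittPathAlgebra K V)ᵐᵒᵖ (Set.range x) = ⊤) :
    Module.Finite K (truncEnd (K := K) (V := V) x n N hN) := by
  let f (j : ι) : (∀ i, truncDeg K V (N - n i) (N - n j)) →ₗ[K] Q :=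
    { toFun H := ∑ i, op (H i : LeavittPathAlgebra K V) • x i
      map_add' H G := by simp [add_smul, Finset.sum_add_distrib]
      map_smul' k H := by simp [Finset.smul_sum] }
  let g : truncEnd (K := K) (V := V) x n N hN →ₗ[K] (∀ j, LinearMap.range (f j)) :=
    { toFun h j := ⟨h.1 (x j), by
        obtain ⟨H, hH, h'⟩ := h.2
        exact ⟨fun i => ⟨H i j, hH i j⟩, (h' j).symm⟩⟩
      map_add' _ _ := rfl
      map_smul' _ _ := rfl }
  refine Module.Finite.of_injective g fun a b hab => Subtype.ext (LinearMap.ext_on_range hspan ?_)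
  exact fun j => congrArg Subtype.val (congrFun hab j)

/-- Degree-`0` endomorphisms of a finitely generated graded module over a Leavitt path algebra
have stable range one. -/
theorem hasStableRangeOne_gradedEnd [Module K Q] [IsScalarTower K (LeavittPathAlgebra K V)ᵐᵒᵖ Q]
    [Module.Finite (LeavittPathAlgebra K V)ᵐᵒᵖ Q] (hgr : DirectSum.IsInternal gr)
    (hsmul : ∀ ⦃i j : ℤ⦄ ⦃m : Q⦄ ⦃a : LeavittPathAlgebra K V⦄, m ∈ gr i → a ∈ deg K V j →
      op a • m ∈ gr (i + j))
    (hK : ∀ n (k : K), ∀ x ∈ gr n, k • x ∈ gr n) :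
    HasStableRangeOne (gradedEnd (V := V) hK) := by
  obtain ⟨s, hs, hspan⟩ := exists_homogeneous_generators (K := K) (V := V) hgr
  let x : s → Q := fun i => i.1.1
  let n : s → ℤ := fun i => i.1.2
  have htrunc : ∀ h : gradedEnd (V := V) hK, ∃ M : ℤ, ∀ N (hN : ∀ i, n i ≤ N), M ≤ N →
      h.1 ∈ truncEnd (K := K) (V := V) x n N hN := by
    intro h
    choose H hH hH' using fun j =>
      exists_homogeneous_coefficients hgr hsmul hs hspan (h.2 _ _ (hs j))
    choose M hM using fun i j => exists_mem_truncDeg K V (hH j i)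
    -- The coefficient of `x i` in `h (x j)` has degree `n j - n i`. It lies in the truncation `(N -
    -- n i, N - n j)` as soon as `N - n j ≥ M i j`.
    obtain ⟨B, hB⟩ := Finite.bddAbove_range fun p : s × s => M p.1 p.2 + n p.2
    refine ⟨B, fun N hN hBN => ⟨fun i j => H j i, fun i j => ?_, hH'⟩⟩
    have := hB ⟨(i, j), rfl⟩
    dsimp only at this
    exact hM i j _ _ (by omega) (by simp only [n]; ring)
  intro a b c habc
  obtain ⟨Ma, ha⟩ := htrunc a
  obtain ⟨Mb, hb⟩ := htrunc b
  obtain ⟨Mc, hc⟩ := htrunc c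
  obtain ⟨B, hB⟩ := Finite.bddAbove_range n
  let N := max (max Ma Mb) (max Mc B)
  have hN : ∀ i, n i ≤ N := fun i =>
    (hB ⟨i, rfl⟩).trans ((le_max_right _ _).trans (le_max_right _ _))
  -- With `N` large, all three elements lie in the finite-dimensional algebra `S`. Stable range one
  -- is applied there, and a unit of `S` is a unit of the larger algebra.
  let S := gradedEnd (V := V) hK ⊓ truncEnd (K := K) (V := V) x n N hN
  have := finite_truncEnd (K := K) (V := V) hN hspan
  have : Module.Finite K S := Submodule.finiteDimensional_of_le
    (S₁ := Subalgebra.toSubmodule S)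
    (S₂ := Subalgebra.toSubmodule (truncEnd (K := K) (V := V) x n N hN)) fun _ h => h.2
  have habc' : a.1 * c.1 + b.1 = 1 := congrArg Subtype.val habc
  obtain ⟨y, hy⟩ := hasStableRangeOne_of_finiteDimensional K S
    ⟨a.1, a.2, ha N hN ((le_max_left _ _).trans (le_max_left _ _))⟩
    ⟨b.1, b.2, hb N hN ((le_max_right _ _).trans (le_max_left _ _))⟩
    ⟨c.1, c.2, hc N hN ((le_max_left _ _).trans (le_max_right _ _))⟩
    (Subtype.ext habc')
  exact ⟨⟨y.1, y.2.1⟩, hy.map (Subalgebra.inclusion (inf_le_left : S ≤ gradedEnd (V := V) hK))⟩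

end Cancellation

/-! ### Schur complements and transvections -/

section Schur

variable {R : Type*} [Ring R] {M N Q : Type*} [AddCommGroup M] [AddCommGroup N] [AddCommGroup Q]
  [Module R M] [Module R N] [Module R Q]

/-- If the `Q`-`Q`-entry `w` of an isomorphism `M × Q ≃ N × Q` is invertible, then its Schur
complement is an isomorphism `M ≃ N`. -/
def schurComplement (F : (M × Q) ≃ₗ[R] (N × Q)) (w : (Module.End R Q)ˣ)
    (hw : ∀ q, (F (0, q)).2 = w.1 q) : M ≃ₗ[R] N :=
  -- The second coordinate is chosen so that the image of `(m, -w⁻¹ F(m,0)₂)` lands in `N × 0`.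
  have hF : ∀ m, F (m, -w.2 (F (m, 0)).2) =
      ((F (m, -w.2 (F (m, 0)).2)).1, 0) := fun m => by
    refine Prod.ext rfl ?_
    have h : ((m, -w.2 (F (m, 0)).2) : M × Q) = (m, 0) - (0, w.2 (F (m, 0)).2) := by simp
    have h' : ∀ q, w.1 (w.2 q) = q := fun q => LinearMap.congr_fun w.3 q
    rw [h, map_sub, Prod.snd_sub, hw, h', sub_self]
  { toFun := fun m => (F (m, -w.2 (F (m, 0)).2)).1
    invFun := fun n => (F.symm (n, 0)).1
    map_add' := fun m m' => by
      rw [← Prod.fst_add, ← map_add]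
      have : ((m + m', 0) : M × Q) = (m, 0) + (m', 0) := by simp
      rw [this, map_add, Prod.snd_add, map_add, neg_add, Prod.mk_add_mk]
    map_smul' := fun r m => by
      have : ((r • m, 0) : M × Q) = r • (m, 0) := by simp
      rw [this, map_smul, Prod.smul_snd, map_smul, ← smul_neg, ← Prod.smul_mk, map_smul]
      rfl
    left_inv := fun m => by
      change (F.symm ((F (m, -w.2 (F (m, 0)).2)).1, 0)).1 = m
      rw [← hF, F.symm_apply_apply]
    right_inv := fun n => by
      have h : F ((F.symm (n, 0)).1, (F.symm (n, 0)).2) = (n, 0) := F.apply_symm_apply _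
      have h' : ∀ q, w.2 (w.1 q) = q := fun q => LinearMap.congr_fun w.4 q
      have h1 : (((F.symm (n, 0)).1, 0) : M × Q) =
        ((F.symm (n, 0)).1, (F.symm (n, 0)).2) - (0, (F.symm (n, 0)).2) := by
        rw [Prod.mk_sub_mk, sub_zero, sub_self]
      have h2 : -w.2 (F ((F.symm (n, 0)).1, 0)).2 = (F.symm (n, 0)).2 := by
        rw [h1, map_sub, h, Prod.snd_sub, hw, zero_sub, map_neg, neg_neg, h']
      change (F ((F.symm (n, 0)).1, -w.2 (F ((F.symm (n, 0)).1, 0)).2)).1 = n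
      rw [h2, h] }

/-- The transvection `(m, q) ↦ (m + t q, q)`. -/
def prodTransvection (t : Q →ₗ[R] M) : (M × Q) ≃ₗ[R] (M × Q) where
  toFun x := (x.1 + t x.2, x.2)
  invFun x := (x.1 - t x.2, x.2)
  map_add' x y := by simp; abel
  map_smul' r x := by simp
  left_inv x := by simp
  right_inv x := by simp

end Schur

open LeavittPathAlgebra in
/-- Finitely generated graded projective modules over a Leavitt path algebra are cancellative. -/
theorem GradedProj.Iso.cancel_right {K : Type*} [Field K] {V : Type*} [Quiver V] [Fintype V]
    [Fintype (Quiver.Total V)] {P P' Q : GradedProj (deg K V)} (h : Iso (P.sum Q) (P'.sum Q)) :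
    Iso P P' := by
  obtain ⟨F, hF⟩ := h
  change (P.carrier × Q.carrier) ≃ₗ[(LeavittPathAlgebra K V)ᵐᵒᵖ] (P'.carrier × Q.carrier) at F
  replace hF : ∀ n x, (x.1 ∈ P.gr n ∧ x.2 ∈ Q.gr n) ↔ ((F x).1 ∈ P'.gr n ∧ (F x).2 ∈ Q.gr n) := hF
  have hF1 : ∀ {n p q}, p ∈ P.gr n → q ∈ Q.gr n →
      (F (p, q)).1 ∈ P'.gr n ∧ (F (p, q)).2 ∈ Q.gr n :=
    fun {n p q} hp hq => (hF n (p, q)).1 ⟨hp, hq⟩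
  have hF2 : ∀ {n p q}, p ∈ P'.gr n → q ∈ Q.gr n →
      (F.symm (p, q)).1 ∈ P.gr n ∧ (F.symm (p, q)).2 ∈ Q.gr n := fun {n p q} hp hq =>
    (hF n (F.symm (p, q))).2 (by rw [F.apply_symm_apply]; exact ⟨hp, hq⟩)
  let : Module K Q.carrier :=
    Module.compHom Q.carrier (algebraMap K (LeavittPathAlgebra K V)ᵐᵒᵖ)
  have : IsScalarTower K (LeavittPathAlgebra K V)ᵐᵒᵖ Q.carrier := ⟨fun k a x => by
    rw [Algebra.smul_def, mul_smul]
    rfl⟩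
  have hK : ∀ n (k : K), ∀ x ∈ Q.gr n, k • x ∈ Q.gr n := fun n k x hx => by
    have := Q.smul_mem hx (SetLike.algebraMap_mem_graded (deg K V) k)
    rwa [add_zero] at this
  let a : gradedEnd (V := V) hK := ⟨LinearMap.snd _ _ _ ∘ₗ F.toLinearMap ∘ₗ LinearMap.inr _ _ _,
    fun n x hx => (hF1 (zero_mem _) hx).2⟩
  let a' : gradedEnd (V := V) hK :=
    ⟨LinearMap.snd _ _ _ ∘ₗ F.symm.toLinearMap ∘ₗ LinearMap.inr _ _ _,
      fun n x hx => (hF2 (zero_mem _) hx).2⟩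
  let t : Q.carrier →ₗ[(LeavittPathAlgebra K V)ᵐᵒᵖ] P.carrier :=
    LinearMap.fst _ _ _ ∘ₗ F.symm.toLinearMap ∘ₗ LinearMap.inr _ _ _
  let b : gradedEnd (V := V) hK :=
    ⟨LinearMap.snd _ _ _ ∘ₗ F.toLinearMap ∘ₗ LinearMap.inl _ _ _ ∘ₗ t,
      fun n x hx => (hF1 (hF2 (zero_mem _) hx).1 (zero_mem _)).2⟩
  have hadd : ∀ p q, F (p, q) = F (p, 0) + F (0, q) := fun p q => by
    rw [← map_add, Prod.mk_add_mk, add_zero, zero_add]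
  -- The relation `a * a' + b = 1` is the `Q`-`Q`-entry of the matrix identity `F ∘ F⁻¹ = 1`.
  obtain ⟨y, w, hw⟩ := hasStableRangeOne_gradedEnd Q.isInternal Q.smul_mem hK a b a'
    (Subtype.ext (LinearMap.ext fun q => by
      change (F (0, (F.symm (0, q)).2)).2 + (F ((F.symm (0, q)).1, 0)).2 = q
      rw [add_comm, ← Prod.snd_add, ← hadd]
      exact congrArg Prod.snd (F.apply_symm_apply (0, q))))
  -- Precomposing `F` with the transvection by `t ∘ y` changes its `Q`-`Q`-entry from `a` to the
  -- unit `a + b * y`. The Schur complement then applies, and every map involved preserves degrees.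
  let G := (prodTransvection (t ∘ₗ y.1)).trans F
  let w' := Units.map (gradedEnd (V := V) hK).val.toMonoidHom w
  have hG : ∀ q, (G (0, q)).2 = w'.1 q := fun q => by
    change (F (0 + t (y.1 q), q)).2 = w.1.1 q
    rw [hw, zero_add, hadd, Prod.snd_add, add_comm]
    rfl
  have hG1 : ∀ {n p q}, p ∈ P.gr n → q ∈ Q.gr n →
      (G (p, q)).1 ∈ P'.gr n ∧ (G (p, q)).2 ∈ Q.gr n :=
    fun {n p q} hp hq => hF1 (add_mem hp (hF2 (zero_mem _) (y.2 n q hq)).1) hq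
  have hG2 : ∀ {n p}, p ∈ P'.gr n → (G.symm (p, 0)).1 ∈ P.gr n :=
    fun {n p} hp => sub_mem (hF2 hp (zero_mem _)).1
      (hF2 (zero_mem _) (y.2 n _ (hF2 hp (zero_mem _)).2)).1
  refine ⟨schurComplement G w' hG, fun n x => ⟨fun hx => ?_, fun hx => ?_⟩⟩
  · exact (hG1 hx (neg_mem (w⁻¹.1.2 n _ (hG1 hx (zero_mem _)).2))).1
  · rw [← (schurComplement G w' hG).symm_apply_apply x]
    exact hG2 hx

/-! ## Corners as graded modules -/

/-- Used to grade `e A`, a retract of `A` by left multiplication with `e`, which preserves degrees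
when `e` has degree `0`. -/
theorem isInternal_of_retract {M N : Type*} [AddCommGroup M] [AddCommGroup N]
    {F : ℤ → AddSubgroup M} {G : ℤ → AddSubgroup N} (hF : DirectSum.IsInternal F)
    (i : N →+ M) (r : M →+ N) (hri : ∀ x, r (i x) = x) (hi : ∀ n, ∀ x ∈ G n, i x ∈ F n)
    (hr : ∀ n, ∀ x ∈ F n, r x ∈ G n) : DirectSum.IsInternal G := by
  classical
  let i' : (DirectSum ℤ fun n => G n) →+ DirectSum ℤ fun n => F n :=
    DirectSum.map fun n => (i.comp (G n).subtype).codRestrict (F n) fun x => hi n x x.2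
  let r' : (DirectSum ℤ fun n => F n) →+ DirectSum ℤ fun n => G n :=
    DirectSum.map fun n => (r.comp (F n).subtype).codRestrict (G n) fun x => hr n x x.2
  have h1 : (DirectSum.coeAddMonoidHom F).comp i' = i.comp (DirectSum.coeAddMonoidHom G) := by
    refine DirectSum.addHom_ext fun n x => ?_
    simp only [i', AddMonoidHom.comp_apply, DirectSum.map_of, DirectSum.coeAddMonoidHom_of]
    rfl
  have h2 : (DirectSum.coeAddMonoidHom G).comp r' = r.comp (DirectSum.coeAddMonoidHom F) := by
    refine DirectSum.addHom_ext fun n x => ?_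
    simp only [r', AddMonoidHom.comp_apply, DirectSum.map_of, DirectSum.coeAddMonoidHom_of]
    rfl
  have h3 : r'.comp i' = AddMonoidHom.id _ := by
    refine DirectSum.addHom_ext fun n x => ?_
    simp only [r', i', AddMonoidHom.comp_apply, DirectSum.map_of, AddMonoidHom.id_apply]
    exact congrArg _ (Subtype.ext (hri x))
  refine ⟨fun x y hxy => ?_, fun x => ?_⟩
  · have h4 : i' x = i' y := hF.1 (by
      change ((DirectSum.coeAddMonoidHom F).comp i') x = ((DirectSum.coeAddMonoidHom F).comp i') y
      rw [h1]
      exact congrArg i hxy)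
    exact (DFunLike.congr_fun h3 x).symm.trans ((congrArg r' h4).trans (DFunLike.congr_fun h3 y))
  · obtain ⟨d, hd⟩ := hF.2 (i x)
    exact ⟨r' d, (DFunLike.congr_fun h2 d).trans ((congrArg r hd).trans (hri x))⟩

section Corner

universe r s

variable {K : Type*} [CommRing K] {A : Type s} [Ring A] [Algebra K A]

/-- The right ideal `e A` of an idempotent `e`. -/
def cornerIdeal (e : A) : Submodule Aᵐᵒᵖ A where
  carrier := {x | e * x = x}
  add_mem' := fun {x y} (hx : e * x = x) (hy : e * y = y) => by
    change e * (x + y) = x + y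
    rw [mul_add, hx, hy]
  zero_mem' := mul_zero e
  smul_mem' := fun a x (hx : e * x = x) => by
    change e * (x * a.unop) = x * a.unop
    rw [← mul_assoc, hx]

/-- The projection `A → e A` onto the right ideal of an idempotent. -/
def toCornerIdeal (e : A) (he : e * e = e) : A →ₗ[Aᵐᵒᵖ] cornerIdeal e where
  toFun a := ⟨e * a, by change e * (e * a) = e * a; rw [← mul_assoc, he]⟩
  map_add' a b := Subtype.ext (mul_add e a b)
  map_smul' c a := Subtype.ext (mul_assoc e a c.unop).symm

theorem toCornerIdeal_coe (e : A) (he : e * e = e) (x : cornerIdeal e) :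
    toCornerIdeal e he x = x := Subtype.ext x.2

/-- The graded projective right module `e A` of an idempotent `e` of degree `0`. -/
def GradedProj.corner (𝒜 : ℤ → Submodule K A) [SetLike.GradedMonoid 𝒜]
    (h𝒜 : DirectSum.IsInternal 𝒜) (e : A) (he : e * e = e) (he0 : e ∈ 𝒜 0) :
    GradedProj.{max r s} 𝒜 where
  -- The lift allows corners of one algebra to be transported to another inside a common universe.
  carrier := ULift.{r} (cornerIdeal e)
  gr n := (𝒜 n).toAddSubgroup.comap
    ((cornerIdeal e).subtype ∘ₗ ULift.moduleEquiv.toLinearMap).toAddMonoidHom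
  isInternal := isInternal_of_retract (F := fun n => (𝒜 n).toAddSubgroup) h𝒜
    ((cornerIdeal e).subtype ∘ₗ ULift.moduleEquiv.toLinearMap).toAddMonoidHom
    (ULift.moduleEquiv.symm.toLinearMap ∘ₗ toCornerIdeal e he).toAddMonoidHom
    (fun x => ULift.ext _ _ (toCornerIdeal_coe e he x.down)) (fun n x hx => hx)
    (fun n x hx => by
      have h : e * x ∈ 𝒜 (0 + n) := SetLike.mul_mem_graded he0 hx
      rw [zero_add] at h
      exact h)
  smul_mem _ _ _ _ hm ha := SetLike.mul_mem_graded (A := 𝒜) hm ha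
  finite := Module.Finite.of_surjective
    (ULift.moduleEquiv.symm.toLinearMap ∘ₗ toCornerIdeal e he)
    fun x => ⟨x.down, ULift.ext _ _ (toCornerIdeal_coe e he x.down)⟩
  projective :=
    have : Module.Projective Aᵐᵒᵖ A := .of_equiv (opLinearEquivSelf A)
    Module.Projective.of_split ((cornerIdeal e).subtype ∘ₗ ULift.moduleEquiv.toLinearMap)
      (ULift.moduleEquiv.symm.toLinearMap ∘ₗ toCornerIdeal e he)
      (LinearMap.ext fun x => ULift.ext _ _ (toCornerIdeal_coe e he x.down))

end Corner

/-! ### From equality on the graded Grothendieck group to equivalence of idempotents -/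

section Equivalence

open LeavittPathAlgebra

/-- Two classes agree in the group completion of a commutative monoid exactly when they agree after
adding some element of the monoid. -/
theorem exists_iso_sum_of_K0gr_map_eq {K : Type*} [CommRing K] {A : Type*} [Ring A] [Algebra K A]
    {B : Type*} [Ring B] [Algebra K B] {𝒜 : ℤ → Submodule K A} {ℬ : ℤ → Submodule K B}
    {φ ψ : A ≃ₐ[K] B} {hφ : φ.IsGraded 𝒜 ℬ} {hψ : ψ.IsGraded 𝒜 ℬ}
    (h : K0gr.map.{k} φ hφ = K0gr.map.{k} ψ hψ) (P : GradedProj.{k} 𝒜) :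
    ∃ Q : GradedProj.{k} ℬ, GradedProj.Iso ((P.transport φ hφ).sum Q) ((P.transport ψ hψ).sum Q) := by
  let p : Vgr.{k} 𝒜 := Quotient.mk _ P
  have h1 := DFunLike.congr_fun h (Algebra.GrothendieckAddGroup.of p)
  have hlift : ∀ (χ : A ≃ₐ[K] B) (hχ : χ.IsGraded 𝒜 ℬ),
      K0gr.map.{k} χ hχ (Algebra.GrothendieckAddGroup.of p) =
        Algebra.GrothendieckAddGroup.of (Vgr.map.{k} χ hχ p) := fun χ hχ =>
    DFunLike.congr_fun (Algebra.GrothendieckAddGroup.lift.symm_apply_apply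
      (Algebra.GrothendieckAddGroup.of.comp (Vgr.map.{k} χ hχ))) p
  rw [hlift, hlift] at h1
  obtain ⟨⟨⟨Q⟩, _⟩, hc⟩ := (AddLocalization.addMonoidOf ⊤).eq_iff_exists.1 h1
  refine ⟨Q, Quotient.exact (s := GradedProj.setoid ℬ) ?_⟩
  exact (add_comm _ _).trans (hc.trans (add_comm _ _))

theorem isGraded_symm {K : Type*} [CommRing K] {A : Type*} [Ring A] [Algebra K A]
    {B : Type*} [Ring B] [Algebra K B] {𝒜 : ℤ → Submodule K A} {ℬ : ℤ → Submodule K B}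
    {φ : A ≃ₐ[K] B} (hφ : φ.IsGraded 𝒜 ℬ) : φ.symm.IsGraded ℬ 𝒜 := fun n b => by
  rw [hφ, φ.apply_symm_apply]

/-- If two graded isomorphisms `φ`, `ψ` agree on the graded Grothendieck group, then `ψ ∘ φ⁻¹`
sends each idempotent of degree `0` to an equivalent one. -/
theorem exists_equivalence_of_K0gr_map_eq {K : Type k} [Field K]
    {E : Type v₁} [Quiver.{e₁} E] [Fintype E] [Fintype (Quiver.Total E)]
    {F : Type v₂} [Quiver.{e₂} F] [Fintype F] [Fintype (Quiver.Total F)]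
    {φ ψ : LeavittPathAlgebra K E ≃ₐ[K] LeavittPathAlgebra K F}
    {hφ : φ.IsGraded (deg K E) (deg K F)} {hψ : ψ.IsGraded (deg K E) (deg K F)}
    (hK : K0gr.map.{max k v₁ e₁ v₂ e₂} φ hφ = K0gr.map.{max k v₁ e₁ v₂ e₂} ψ hψ)
    {e : LeavittPathAlgebra K F} (he : e * e = e) (he0 : e ∈ deg K F 0) :
    ∃ x ∈ deg K F 0, ∃ y ∈ deg K F 0, x * y = e ∧ y * x = ψ (φ.symm e) ∧ e * x = x ∧ y * e = y := by
  let P : GradedProj.{max k v₁ e₁ v₂ e₂} (deg K F) :=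
    GradedProj.corner.{max v₁ e₁} (deg K F) (isInternal_deg K F) e he he0
  -- Moving `eB` along `φ⁻¹` and back along `φ` returns its original action. Going back along `ψ`
  -- instead makes `b` act as right multiplication by `φ (ψ⁻¹ b)`. Hence the twisted linearity `hg`
  -- of the isomorphism.
  obtain ⟨Q, hQ⟩ := exists_iso_sum_of_K0gr_map_eq hK (P.transport φ.symm (isGraded_symm hφ))
  obtain ⟨f, hf⟩ := hQ.cancel_right
  let g : ULift.{max v₁ e₁} (cornerIdeal e) ≃ ULift.{max v₁ e₁} (cornerIdeal e) := f.toEquiv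
  have hg : ∀ (x : cornerIdeal e) b, (g ⟨MulOpposite.op b • x⟩).down.1 =
      (g ⟨x⟩).down.1 * φ (ψ.symm b) := by
    intro x b
    have h : (g ⟨MulOpposite.op (φ (φ.symm b)) • x⟩).down.1 =
        (g ⟨x⟩).down.1 * φ (ψ.symm b) :=
      congrArg (fun t : ULift.{max v₁ e₁} (cornerIdeal e) => t.down.1)
        (f.map_smul (MulOpposite.op b) (ULift.up x : ULift.{max v₁ e₁} (cornerIdeal e)))
    rwa [φ.apply_symm_apply] at h
  have hdeg : ∀ x : ULift.{max v₁ e₁} (cornerIdeal e),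
      x.down.1 ∈ deg K F 0 ↔ (g x).down.1 ∈ deg K F 0 := fun x => hf 0 x
  let o : cornerIdeal e := ⟨e, he⟩
  have hmul : ∀ x : cornerIdeal e, MulOpposite.op x.1 • o = x := fun x => Subtype.ext x.2
  -- Since `e` generates `eB`, the isomorphism and its inverse are determined by `g e` and `g⁻¹ e`.
  -- Their being mutually inverse becomes `h1` and `h2`.
  let x' := g.symm ⟨o⟩
  let y' := g ⟨o⟩
  have hx' : e * x'.down.1 = x'.down.1 := x'.down.2
  have hy' : e * y'.down.1 = y'.down.1 := y'.down.2
  have hgx' : g x' = ⟨o⟩ := g.apply_symm_apply _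
  have h1 : y'.down.1 * φ (ψ.symm x'.down.1) = e := by
    rw [← hg, hmul]
    exact congrArg (fun t => t.down.1) hgx'
  have h2 : x'.down.1 * ψ (φ.symm y'.down.1) = e := by
    have h := hg x'.down (ψ (φ.symm y'.down.1))
    rw [ψ.symm_apply_apply, φ.apply_symm_apply] at h
    have h3 : (g ⟨x'.down⟩).down.1 = e := congrArg (fun t => t.down.1) hgx'
    rw [h3, hy'] at h
    exact congrArg (fun t => t.down.1) (g.injective (ULift.ext _ _ (Subtype.ext h)))
  have h3 : ψ (φ.symm y'.down.1) * x'.down.1 = ψ (φ.symm e) := by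
    have := congrArg (fun t => ψ (φ.symm t)) h1
    simpa only [map_mul, φ.symm_apply_apply, ψ.apply_symm_apply] using this
  have hy0 : y'.down.1 ∈ deg K F 0 := (hdeg ⟨o⟩).1 he0
  refine ⟨x'.down.1, (hdeg x').2 (by rw [hgx']; exact he0), ψ (φ.symm y'.down.1),
    (hψ 0 _).1 ((isGraded_symm hφ 0 _).1 hy0), h2, h3, hx', ?_⟩
  exact (congrArg (ψ (φ.symm y'.down.1) * ·) h2.symm).trans
    (by rw [← mul_assoc, h3, ← map_mul, ← map_mul, hy'])

end Equivalence

/-! ### Leavitt families with the same vertices -/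

section Families

variable {V : Type*} [Quiver V] [Fintype V] [Fintype (Quiver.Total V)] {A : Type*} [Ring A]

theorem IsLeavittFamily.map {B : Type*} [Ring B] {x : LeavittGen V → A}
    (hx : IsLeavittFamily V x) (f : A →+* B) : IsLeavittFamily V (f ∘ x) := by
  refine ⟨?_, ?_, ?_, ?_, ?_, ?_, ?_, ?_, ?_, ?_⟩ <;> intros <;>
    simp only [Function.comp_apply, ← map_mul, ← map_sum]
  · rw [hx.vertex_mul_self]
  · rw [hx.vertex_mul_vertex_of_ne _ _ ‹_›, map_zero]
  · rw [hx.sum_vertex, map_one]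
  · rw [hx.source_mul_edge]
  · rw [hx.edge_mul_range]
  · rw [hx.range_mul_ghost]
  · rw [hx.ghost_mul_source]
  · rw [hx.ghost_mul_edge_self]
  · rw [hx.ghost_mul_edge_of_ne _ _ ‹_›, map_zero]
  · rw [hx.vertex_eq_sum _ ‹_›]

open scoped Classical in
/-- The element carrying the edges of a Leavitt family `x` to those of a Leavitt family `y` with
the same vertices. -/
noncomputable def leavittTransition (x y : LeavittGen V → A) : A :=
  ∑ e : Quiver.Total V, y (.edge e) * x (.ghost e) +
    ∑ v : V with ¬ ∃ e : Quiver.Total V, e.left = v, x (.vertex v)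

variable {x y : LeavittGen V → A}

theorem leavittTransition_mul_edge (hx : IsLeavittFamily V x) (hy : IsLeavittFamily V y)
    (hxy : ∀ v, x (.vertex v) = y (.vertex v)) (e : Quiver.Total V) :
    leavittTransition x y * x (.edge e) = y (.edge e) := by
  classical
  rw [leavittTransition, add_mul, Finset.sum_mul, Finset.sum_mul,
    Finset.sum_eq_single e (fun f _ hf => by
      rw [mul_assoc, hx.ghost_mul_edge_of_ne f e hf, mul_zero]) (by simp),
    Finset.sum_eq_zero fun v hv => ?_, mul_assoc, hx.ghost_mul_edge_self, hxy, hy.edge_mul_range,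
    add_zero]
  have hve : v ≠ e.left := fun h => (Finset.mem_filter.1 hv).2 ⟨e, h.symm⟩
  rw [← hx.source_mul_edge, ← mul_assoc, hx.vertex_mul_vertex_of_ne _ _ hve, zero_mul]

theorem ghost_mul_leavittTransition (hx : IsLeavittFamily V x) (hy : IsLeavittFamily V y)
    (hxy : ∀ v, x (.vertex v) = y (.vertex v)) (e : Quiver.Total V) :
    y (.ghost e) * leavittTransition x y = x (.ghost e) := by
  classical
  rw [leavittTransition, mul_add, Finset.mul_sum, Finset.mul_sum,
    Finset.sum_eq_single e (fun f _ hf => by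
      rw [← mul_assoc, hy.ghost_mul_edge_of_ne e f hf.symm, zero_mul]) (by simp),
    Finset.sum_eq_zero fun v hv => ?_, ← mul_assoc, hy.ghost_mul_edge_self, ← hxy,
    hx.range_mul_ghost, add_zero]
  have hve : e.left ≠ v := fun h => (Finset.mem_filter.1 hv).2 ⟨e, h⟩
  rw [← hy.ghost_mul_source, mul_assoc, hxy, hy.vertex_mul_vertex_of_ne _ _ hve, mul_zero]

/-- Each summand is fixed on both sides by a single vertex, namely the source of its edge or the
sink itself, so it commutes with every vertex. -/
theorem leavittTransition_commute_vertex (hx : IsLeavittFamily V x) (hy : IsLeavittFamily V y)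
    (hxy : ∀ v, x (.vertex v) = y (.vertex v)) (v : V) :
    leavittTransition x y * x (.vertex v) = x (.vertex v) * leavittTransition x y := by
  classical
  have key : ∀ w a, x (.vertex w) * a = a → a * x (.vertex w) = a →
      a * x (.vertex v) = x (.vertex v) * a := by
    intro w a h1 h2
    by_cases h : w = v
    · subst h
      rw [h1, h2]
    · rw [← h1, ← mul_assoc (x (.vertex v)), hx.vertex_mul_vertex_of_ne v w (Ne.symm h), zero_mul,
        h1, ← h2, mul_assoc, hx.vertex_mul_vertex_of_ne w v h, mul_zero]
  rw [leavittTransition, add_mul, mul_add, Finset.sum_mul, Finset.sum_mul, Finset.mul_sum,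
    Finset.mul_sum]
  congr 1
  · refine Finset.sum_congr rfl fun e _ => key e.left _ ?_ ?_
    · rw [← mul_assoc, hxy, hy.source_mul_edge]
    · rw [mul_assoc, hx.ghost_mul_source]
  · exact Finset.sum_congr rfl fun w _ => key w _ (hx.vertex_mul_self w) (hx.vertex_mul_self w)

/-- The transition turns each `x_e y_e^*` into `y_e y_e^*`, and these sum to the vertices that emit
edges. The sinks, which it fixes, supply the rest of `1`. -/
theorem leavittTransition_mul_swap (hx : IsLeavittFamily V x) (hy : IsLeavittFamily V y)
    (hxy : ∀ v, x (.vertex v) = y (.vertex v)) :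
    leavittTransition x y * leavittTransition y x = 1 := by
  classical
  have h1 : ∀ v, (¬ ∃ e : Quiver.Total V, e.left = v) →
      leavittTransition x y * x (.vertex v) = x (.vertex v) := by
    intro v hv
    rw [leavittTransition, add_mul, Finset.sum_mul, Finset.sum_mul,
      Finset.sum_eq_zero fun e _ => ?_, Finset.sum_eq_single v (fun w _ hw =>
        hx.vertex_mul_vertex_of_ne w v hw) (fun h => by simp [hv] at h), zero_add,
      hx.vertex_mul_self]
    rw [← hx.ghost_mul_source, mul_assoc, mul_assoc,
      hx.vertex_mul_vertex_of_ne e.left v (fun h => hv ⟨e, h⟩), mul_zero, mul_zero]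
  have h2 : ∑ e : Quiver.Total V, y (.edge e) * y (.ghost e) =
      ∑ v : V with ∃ e : Quiver.Total V, e.left = v, y (.vertex v) := by
    rw [Finset.sum_congr rfl fun v hv => hy.vertex_eq_sum v (Finset.mem_filter.1 hv).2,
      ← Finset.sum_fiberwise_of_maps_to (t := Finset.univ.filter fun v : V =>
        ∃ e : Quiver.Total V, e.left = v) (g := fun e : Quiver.Total V => e.left) (by simp)]
  nth_rw 2 [leavittTransition]
  rw [mul_add, Finset.mul_sum, Finset.mul_sum,
    Finset.sum_congr rfl fun e _ => (mul_assoc _ _ _).symm.trans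
      (congrArg (· * y (.ghost e)) (leavittTransition_mul_edge hx hy hxy e)), h2,
    Finset.sum_congr rfl fun v hv => (congrArg _ (hxy v).symm).trans
      ((h1 v (Finset.mem_filter.1 hv).2).trans (hxy v)),
    Finset.sum_filter_add_sum_filter_not, hy.sum_vertex]

/-- The element `leavittTransition x y` as a unit. -/
noncomputable def leavittTransitionUnit (hx : IsLeavittFamily V x) (hy : IsLeavittFamily V y)
    (hxy : ∀ v, x (.vertex v) = y (.vertex v)) : Aˣ where
  val := leavittTransition x y
  inv := leavittTransition y x
  val_inv := leavittTransition_mul_swap hx hy hxy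
  inv_val := leavittTransition_mul_swap hy hx fun v => (hxy v).symm

end Families

/-! ## Graded isomorphisms agreeing on the graded Grothendieck group -/

section Main

open LeavittPathAlgebra

theorem deg_zero_mul_mem {K : Type*} [Field K] {V : Type*} [Quiver V] [Fintype V]
    [Fintype (Quiver.Total V)] {n : ℤ} {a b : LeavittPathAlgebra K V} (ha : a ∈ deg K V 0)
    (hb : b ∈ deg K V n) : a * b ∈ deg K V n := by
  simpa using SetLike.mul_mem_graded ha hb

theorem mul_deg_zero_mem {K : Type*} [Field K] {V : Type*} [Quiver V] [Fintype V]
    [Fintype (Quiver.Total V)] {n : ℤ} {a b : LeavittPathAlgebra K V} (ha : a ∈ deg K V n)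
    (hb : b ∈ deg K V 0) : a * b ∈ deg K V n := by
  simpa using SetLike.mul_mem_graded ha hb

theorem leavittTransition_mem_deg {K : Type*} [Field K] {V : Type*} [Quiver V] [Fintype V]
    [Fintype (Quiver.Total V)] {x y : LeavittGen V → LeavittPathAlgebra K V}
    (hv : ∀ v, x (.vertex v) ∈ deg K V 0) (hx : ∀ e, x (.ghost e) ∈ deg K V (-1))
    (hy : ∀ e, y (.edge e) ∈ deg K V 1) : leavittTransition x y ∈ deg K V 0 :=
  add_mem (sum_mem fun e _ => by simpa using SetLike.mul_mem_graded (hy e) (hx e))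
    (sum_mem fun v _ => hv v)

/-- An algebra endomorphism sending each vertex to an equivalent idempotent sends each vertex to
its conjugate under a fixed unit. -/
theorem exists_unit_conj_vertex {K : Type*} [Field K] {V : Type*} [Quiver V] [Fintype V]
    [Fintype (Quiver.Total V)] (α : LeavittPathAlgebra K V →ₐ[K] LeavittPathAlgebra K V)
    (h : ∀ v, ∃ x ∈ deg K V 0, ∃ y ∈ deg K V 0, x * y = vertex K V v ∧
      y * x = α (vertex K V v) ∧ vertex K V v * x = x ∧ y * vertex K V v = y) :
    ∃ u : (LeavittPathAlgebra K V)ˣ, (u : LeavittPathAlgebra K V) ∈ deg K V 0 ∧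
      (↑u⁻¹ : LeavittPathAlgebra K V) ∈ deg K V 0 ∧
      ∀ v, ↑u⁻¹ * α (vertex K V v) * u = vertex K V v := by
  classical
  have H := isLeavittFamily_gen K V
  choose x hx y hy hxy hyx hvx hyv using h
  have hyw : ∀ v w, v ≠ w → y v * x w = 0 := fun v w hvw => by
    rw [← hyv, ← hvx, mul_assoc, ← mul_assoc (vertex K V v), H.vertex_mul_vertex_of_ne v w hvw,
      zero_mul, mul_zero]
  have hay : ∀ v, α (vertex K V v) * y v = y v := fun v => by
    rw [← hyx, mul_assoc, hxy, hyv]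
  have hxa : ∀ v, x v * α (vertex K V v) = x v := fun v => by
    rw [← hyx, ← mul_assoc, hxy, hvx]
  have haa : ∀ v w, v ≠ w → α (vertex K V v) * α (vertex K V w) = 0 := fun v w hvw => by
    rw [← map_mul, H.vertex_mul_vertex_of_ne v w hvw, map_zero]
  have hxw : ∀ v w, v ≠ w → x v * y w = 0 := fun v w hvw => by
    rw [← hxa, ← hay, mul_assoc, ← mul_assoc (α (vertex K V v)), haa v w hvw, zero_mul, mul_zero]
  -- The cross terms `y v * x w` and `x v * y w` with `v ≠ w` vanish by orthogonality of the
  -- vertices and of their images. The two products are therefore `∑ α(v) = α(1) = 1` and `∑ v = 1`.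
  let u : (LeavittPathAlgebra K V)ˣ :=
    { val := ∑ v, y v
      inv := ∑ v, x v
      val_inv := by
        rw [Finset.sum_mul_sum, ← map_one α, ← H.sum_vertex, map_sum]
        refine Finset.sum_congr rfl fun v _ => ?_
        rw [Finset.sum_eq_single v (fun w _ hw => hyw v w hw.symm) (by simp), hyx]
      inv_val := by
        rw [Finset.sum_mul_sum, ← H.sum_vertex]
        refine Finset.sum_congr rfl fun v _ => ?_
        rw [Finset.sum_eq_single v (fun w _ hw => hxw v w hw.symm) (by simp), hxy] }
  refine ⟨u, sum_mem fun v _ => hy v, sum_mem fun v _ => hx v, fun v => ?_⟩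
  change (∑ w, x w) * α (vertex K V v) * ∑ w, y w = vertex K V v
  rw [Finset.sum_mul, Finset.sum_eq_single v (fun w _ hw => by
    rw [← hxa, mul_assoc, haa w v hw, mul_zero]) (by simp), hxa, Finset.mul_sum,
    Finset.sum_eq_single v (fun w _ hw => hxw v w hw.symm) (by simp), hxy]

/-- Conjugation by a unit. -/
def conjHom {A : Type*} [Ring A] (u : Aˣ) : A →+* A where
  toFun a := ↑u⁻¹ * a * u
  map_one' := by simp
  map_mul' a b := by simp [mul_assoc]
  map_zero' := by simp
  map_add' a b := by simp [mul_add, add_mul]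

end Main

theorem mainTheorem5 (K : Type k) [Field K]
    (E : Type v₁) [Quiver.{e₁} E] [Fintype E] [Fintype (Quiver.Total E)]
    (F : Type v₂) [Quiver.{e₂} F] [Fintype F] [Fintype (Quiver.Total F)]
    (hE : HasNoSources E) (hF : HasNoSources F)
    (φ ψ : LeavittPathAlgebra K E ≃ₐ[K] LeavittPathAlgebra K F)
    (hφ : φ.IsGraded (LeavittPathAlgebra.deg K E) (LeavittPathAlgebra.deg K F))
    (hψ : ψ.IsGraded (LeavittPathAlgebra.deg K E) (LeavittPathAlgebra.deg K F))
    (hK : K0gr.map.{max k v₁ e₁ v₂ e₂} φ hφ = K0gr.map.{max k v₁ e₁ v₂ e₂} ψ hψ) :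
    ∃ (u z : (LeavittPathAlgebra K F)ˣ)
      (hz : ∀ v : F, (z : LeavittPathAlgebra K F) *
          (u * LeavittPathAlgebra.vertex K F v * ↑u⁻¹) =
        (u * LeavittPathAlgebra.vertex K F v * ↑u⁻¹) * z),
      (u : LeavittPathAlgebra K F) ∈ LeavittPathAlgebra.deg K F 0 ∧
      (↑u⁻¹ : LeavittPathAlgebra K F) ∈ LeavittPathAlgebra.deg K F 0 ∧
      (z : LeavittPathAlgebra K F) ∈ LeavittPathAlgebra.deg K F 0 ∧
      (↑z⁻¹ : LeavittPathAlgebra K F) ∈ LeavittPathAlgebra.deg K F 0 ∧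
      (ψ : LeavittPathAlgebra K E →ₐ[K] LeavittPathAlgebra K F) =
        (LeavittPathAlgebra.theta u z hz).comp φ := by
  let α : LeavittPathAlgebra K F →ₐ[K] LeavittPathAlgebra K F :=
    (ψ : LeavittPathAlgebra K E →ₐ[K] LeavittPathAlgebra K F).comp φ.symm
  have hα : ∀ n a, a ∈ LeavittPathAlgebra.deg K F n → α a ∈ LeavittPathAlgebra.deg K F n :=
    fun n a ha => (hψ n _).1 ((isGraded_symm hφ n _).1 ha)
  have H := LeavittPathAlgebra.isLeavittFamily_gen K F
  obtain ⟨u, hu, hu', huv⟩ := exists_unit_conj_vertex α fun v =>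
    exists_equivalence_of_K0gr_map_eq hK (H.vertex_mul_self v)
      (LeavittPathAlgebra.vertex_mem_deg K F v)
  -- The family `u⁻¹ α(·) u` has the original vertices, so it is comparable with the canonical
  -- family through a transition unit.
  let y := ((conjHom u).comp (α : LeavittPathAlgebra K F →+* LeavittPathAlgebra K F)) ∘
    LeavittPathAlgebra.gen K F
  have hy : IsLeavittFamily F y := H.map _
  have hyα : ∀ g, α (LeavittPathAlgebra.gen K F g) = u * y g * ↑u⁻¹ := fun g => by
    change _ = u * (↑u⁻¹ * α (LeavittPathAlgebra.gen K F g) * u) * ↑u⁻¹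
    simp [mul_assoc]
  have hyv : ∀ v, LeavittPathAlgebra.gen K F (.vertex v) = y (.vertex v) := fun v => (huv v).symm
  have hydeg : ∀ n g, LeavittPathAlgebra.gen K F g ∈ LeavittPathAlgebra.deg K F n →
      y g ∈ LeavittPathAlgebra.deg K F n := fun n g hg =>
    mul_deg_zero_mem (deg_zero_mul_mem hu' (hα n _ hg)) hu
  let d := leavittTransitionUnit H hy hyv
  have hd : (d : LeavittPathAlgebra K F) ∈ LeavittPathAlgebra.deg K F 0 :=
    leavittTransition_mem_deg (LeavittPathAlgebra.vertex_mem_deg K F)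
      (LeavittPathAlgebra.ghost_mem_deg K F)
      fun e => hydeg 1 _ (LeavittPathAlgebra.edge_mem_deg K F e)
  have hd' : (↑d⁻¹ : LeavittPathAlgebra K F) ∈ LeavittPathAlgebra.deg K F 0 :=
    leavittTransition_mem_deg (fun v => hydeg 0 _ (LeavittPathAlgebra.vertex_mem_deg K F v))
      (fun e => hydeg (-1) _ (LeavittPathAlgebra.ghost_mem_deg K F e))
      (LeavittPathAlgebra.edge_mem_deg K F)
  have hdv : ∀ v, (d : LeavittPathAlgebra K F) * LeavittPathAlgebra.vertex K F v =
      LeavittPathAlgebra.vertex K F v * d := leavittTransition_commute_vertex H hy hyv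
  have hde : ∀ e, (d : LeavittPathAlgebra K F) * LeavittPathAlgebra.edge K F e = y (.edge e) :=
    leavittTransition_mul_edge H hy hyv
  have hdg : ∀ e, LeavittPathAlgebra.ghost K F e * (↑d⁻¹ : LeavittPathAlgebra K F) =
      y (.ghost e) := ghost_mul_leavittTransition hy H fun v => (hyv v).symm
  have hconj : ∀ v, ((u * d : (LeavittPathAlgebra K F)ˣ) : LeavittPathAlgebra K F) *
      LeavittPathAlgebra.vertex K F v * ↑(u * d)⁻¹ =
        u * LeavittPathAlgebra.vertex K F v * ↑u⁻¹ := fun v => by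
    rw [Units.val_mul, mul_assoc (u : LeavittPathAlgebra K F), hdv, mul_inv_rev, Units.val_mul]
    simp [mul_assoc]
  -- As `d` commutes with the vertices, conjugation by `u * d` acts on them as conjugation by `u`
  -- does. On an edge, `(ud) e (ud)⁻¹ · u d u⁻¹ = u (d e) u⁻¹ = α(e)`, which forces `z = u d u⁻¹`;
  -- on a ghost edge the same choice gives `u (e^* d⁻¹) u⁻¹ = α(e^*)`.
  refine ⟨u * d, u * d * u⁻¹, fun v => ?_, mul_deg_zero_mem hu hd, ?_,
    mul_deg_zero_mem (mul_deg_zero_mem hu hd) hu', ?_, ?_⟩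
  · rw [hconj]
    simp only [Units.val_mul, mul_assoc, Units.inv_mul_cancel_left]
    rw [← mul_assoc (d : LeavittPathAlgebra K F), hdv, mul_assoc]
  · rw [mul_inv_rev, Units.val_mul]
    exact mul_deg_zero_mem hd' hu'
  · rw [mul_inv_rev, mul_inv_rev, inv_inv, Units.val_mul, Units.val_mul]
    exact mul_deg_zero_mem hu (mul_deg_zero_mem hd' hu')
  · have hψα : (ψ : LeavittPathAlgebra K E →ₐ[K] LeavittPathAlgebra K F) =
        α.comp (φ : LeavittPathAlgebra K E →ₐ[K] LeavittPathAlgebra K F) :=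
      AlgHom.ext fun a => by simp [α]
    rw [hψα]
    congr 1
    refine LeavittPathAlgebra.algHom_ext fun g => ?_
    rw [LeavittPathAlgebra.theta, LeavittPathAlgebra.lift_gen, hyα]
    cases g with
    | vertex v => rw [LeavittPathAlgebra.thetaGen, hconj, ← hyv]
    | edge e =>
      rw [LeavittPathAlgebra.thetaGen, ← hde]
      simp [mul_assoc]
    | ghost e =>
      rw [LeavittPathAlgebra.thetaGen, ← hdg]
      simp [mul_assoc]
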